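/- Let $\mathcal X$ be a smooth (Hausdorff) manifold without boundary of dimension $n\ge 1$, let $W\to\mathcal X$ be a smooth real vector bundle of finite rank $m$, and let $k\ge 1$. Write $U=J^{k-1}W$ for the bundle of $(k-1)$-jets of sections of $W$, $\pi^1_0:J^1U\to U$, $j^1s(x)\mapsto s(x)$, for the projection, and $V^0J^1U=\ker\pi^1_0$. A *non-holonomic stress* at $x$ is an element of $L(J^1U,\bigwedge^nT^*\mathcal X)_x$ and a *traction hyper-stress* at $x$ is an element of $L(U,\bigwedge^{n-1}T^*\mathcal X)_x$; (smooth) fields of such objects are smooth sections of these vector bundles. (a) For each $x$ there is a unique linear isomorphism $\nu_x:L(T_x\mathcal X,U_x)\to V^0J^1U_x$ such that $\nu_x(df_x\otimes s(x))=j^1(fs)(x)$ for every smooth section $s$ of $U$ and every smooth function $f$ with $f(x)=0$. The linear maps $$T_x\mathcal X\otimes\textstyle\bigwedge^nT_x^*\mathcal X\to\bigwedge^{n-1}T_x^*\mathcal X,\quad v\otimes\theta\mapsto v\lrcorner\theta,$$ $$h_x:T_x\mathcal X\otimes U_x^*\otimes\textstyle\bigwedge^nT_x^*\mathcal X\to L(L(T_x\mathcal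 X,U_x),\bigwedge^nT_x^*\mathcal X),\quad v\otimes g\otimes\theta\mapsto(A\mapsto g(Av)\,\theta),$$ $$c_x:T_x\mathcal X\otimes U_x^*\otimes\textstyle\bigwedge^nT_x^*\mathcal X\to L(U_x,\bigwedge^{n-1}T_x^*\mathcal X),\quad v\otimes g\otimes\theta\mapsto(u\mapsto g(u)\,v\lrcorner\theta),$$ are isomorphisms. (b) There is a natural map $$p_\sigma:L(J^1(J^{k-1}W),\textstyle\bigwedge^nT^*\mathcal X)\to L(J^{k-1}W,\bigwedge^{n-1}T^*\mathcal X),$$ linear in each fibre, which restricts a non-holonomic stress to $V^0J^1U\cong L(T\mathcal X,U)$ and then applies the isomorphisms of (a). That is, $p_\sigma$ is the unique map with $p_\sigma(P)=c_x(\tau)$ whenever $P\in L(J^1U,\bigwedge^nT^*\mathcal X)_x$ and $h_x(\tau)=P\circ\nu_x$. It is a smooth morphism of vector bundles over $\mathcal X$; in particular every smooth non-holonomic stress field $P$ determines a unique smooth traction hyper-stress field $\sigma$ with $\sigma(x)=p_\sigma(P(x))$ for all $x$. (c) Let $(x^j)$ be local coordinates of $\mathcal X$, together with a local trivialization of $W$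 and a basis of its typical fibre. They induce components $u^\alpha_J$ of elements of $U$ and components $A^\alpha_J$, $A^\alpha_{Jj}$ of elements $A$ of $J^1U$, where $J$ runs through the non-decreasing multi-indices with $0\le|J|\le k-1$ (for $A=j^1s(x)$ these are the components of $s$ at $x$ and their partial derivatives with respect to $x^j$). At each point of the coordinate domain each non-holonomic stress has unique components $P_\alpha^J$, $\underline P_\alpha^{Jj}$ with $$P(A)=\Bigl(\sum_{J,\alpha}P_\alpha^JA^\alpha_J+\sum_{J,\alpha,j}\underline P_\alpha^{Jj}A^\alpha_{Jj}\Bigr)\,dx^1\wedge\dots\wedge dx^n,$$ and $\sigma=p_\sigma(P)$ has the unique components $\sigma_\alpha^{Jj}=\underline P_\alpha^{Jj}$ in $$\sigma(u)=\sum_{J,\alpha,j}\sigma_\alpha^{Jj}u_J^\alpha\;\partial_j\lrcorner(dx^1\wedge\dots\wedge dx^n).$$ -/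

import Mathlib

open Bundle Set Filter Topology
open scoped Manifold ContDiff Bundle Nat

noncomputable section

set_option linter.unusedSectionVars false

namespace HyperStress

section Calculus

variable {E E' F G : Type*} [NormedAddCommGroup E] [NormedSpace ℝ E]
  [NormedAddCommGroup E'] [NormedSpace ℝ E'] [NormedAddCommGroup F] [NormedSpace ℝ F]
  [NormedAddCommGroup G] [NormedSpace ℝ G]

theorem iteratedFDeriv_comp_swap {f : E → F} (n : ℕ) : ∀ {x : E}, ContDiffAt ℝ (n + 1 : ℕ) f x →
    ∀ (i : Fin n) (v : Fin (n + 1) → E),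
    iteratedFDeriv ℝ (n + 1) f x (v ∘ Equiv.swap i.castSucc i.succ) =
      iteratedFDeriv ℝ (n + 1) f x v := by
  induction n with
  | zero => intro x _ i; exact i.elim0
  | succ n ih =>
    intro x hf i v
    have hd : DifferentiableAt ℝ (iteratedFDeriv ℝ (n + 1) f) x :=
      (hf.iteratedFDeriv_right (m := 1) (by norm_cast; omega)).differentiableAt (by norm_num)
    rw [hd.iteratedFDeriv_succ_apply_left', hd.iteratedFDeriv_succ_apply_left']
    induction i using Fin.cases with
    | zero =>
      have key : ∀ w : Fin (n + 1 + 1) → E,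
          fderiv ℝ (fun y => iteratedFDeriv ℝ (n + 1) f y (Fin.tail w)) x (w 0) =
          fderiv ℝ (fderiv ℝ (fun z => iteratedFDeriv ℝ n f z (Fin.tail (Fin.tail w)))) x
            (w 0) (w 1) := by
        intro w
        have h2 : ContDiffAt ℝ 2 (iteratedFDeriv ℝ n f) x :=
          hf.iteratedFDeriv_right (by norm_cast; omega)
        have h3 : ContDiffAt ℝ 2 (fun z => iteratedFDeriv ℝ n f z (Fin.tail (Fin.tail w))) x :=
          (ContinuousMultilinearMap.apply ℝ (fun _ : Fin n => E) F
            (Fin.tail (Fin.tail w))).contDiff.contDiffAt.comp x h2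
        have h4 : DifferentiableAt ℝ
            (fderiv ℝ (fun z => iteratedFDeriv ℝ n f z (Fin.tail (Fin.tail w)))) x :=
          (h3.fderiv_right (m := 1) (by norm_num)).differentiableAt (by norm_num)
        have hev : (fun y => iteratedFDeriv ℝ (n + 1) f y (Fin.tail w)) =ᶠ[𝓝 x] fun y =>
            fderiv ℝ (fun z => iteratedFDeriv ℝ n f z (Fin.tail (Fin.tail w))) y (w 1) := by
          filter_upwards [h2.eventually (by simp)] with y hy
          rw [(hy.differentiableAt (by norm_num)).iteratedFDeriv_succ_apply_left']
          rfl
        rw [hev.fderiv_eq, fderiv_clm_apply h4 (differentiableAt_const _)]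
        simp
      have h5 : ContDiffAt ℝ 2 (fun z => iteratedFDeriv ℝ n f z (Fin.tail (Fin.tail v))) x :=
        (ContinuousMultilinearMap.apply ℝ (fun _ : Fin n => E) F
          (Fin.tail (Fin.tail v))).contDiff.contDiffAt.comp x
            (hf.iteratedFDeriv_right (by norm_cast; omega))
      have ht : Fin.tail (Fin.tail (v ∘ Equiv.swap (Fin.castSucc (0 : Fin (n + 1)))
          (Fin.succ (0 : Fin (n + 1))))) = Fin.tail (Fin.tail v) := by
        funext j
        simp only [Fin.tail, Function.comp_apply]
        congr 1
      rw [key, key, ht, h5.isSymmSndFDerivAt (by simp)]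
      simp
    | succ i =>
      have h0 : (v ∘ Equiv.swap i.succ.castSucc i.succ.succ) 0 = v 0 := by
        simp only [Function.comp_apply]
        congr 1
      have ht : Fin.tail (v ∘ Equiv.swap i.succ.castSucc i.succ.succ) =
          Fin.tail v ∘ Equiv.swap i.castSucc i.succ := by
        funext j
        simp only [Fin.tail, Function.comp_apply]
        congr 1
        rw [← Fin.succ_castSucc]
        exact (Function.Injective.swap_apply (Fin.succ_injective _) _ _ _)
      rw [h0, ht]
      have hev : (fun y => iteratedFDeriv ℝ (n + 1) f y
          (Fin.tail v ∘ Equiv.swap i.castSucc i.succ)) =ᶠ[𝓝 x]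
          fun y => iteratedFDeriv ℝ (n + 1) f y (Fin.tail v) := by
        have : ContDiffAt ℝ (n + 1 : ℕ) f x := hf.of_le (by norm_cast; omega)
        filter_upwards [this.eventually (by simp)] with y hy
        exact ih hy i _
      rw [hev.fderiv_eq]

/-- Schwarz's theorem for derivatives of arbitrary order. -/
theorem iteratedFDeriv_comp_perm {f : E → F} {n : ℕ} {x : E} (hf : ContDiffAt ℝ n f x)
    (v : Fin n → E) (σ : Equiv.Perm (Fin n)) :
    iteratedFDeriv ℝ n f x (v ∘ σ) = iteratedFDeriv ℝ n f x v := by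
  cases n with
  | zero => congr 1; exact Subsingleton.elim _ _
  | succ n =>
    have hσ : σ ∈ Submonoid.closure
        (Set.range fun i : Fin n => Equiv.swap i.castSucc i.succ) := by
      rw [Equiv.Perm.mclosure_swap_castSucc_succ]; trivial
    induction hσ using Submonoid.closure_induction generalizing v with
    | mem τ hτ =>
      obtain ⟨i, rfl⟩ := hτ
      exact iteratedFDeriv_comp_swap n hf i v
    | one => rfl
    | mul σ τ _ _ h1 h2 =>
      rw [← h1 v, ← h2 (v ∘ σ)]
      rfl

theorem exists_open_contDiffOn {f : E → F} {x : E} (hf : ContDiffAt ℝ ∞ f x) (n : ℕ) :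
    ∃ u, IsOpen u ∧ x ∈ u ∧ ContDiffOn ℝ n f u := by
  obtain ⟨u, hu, hxu, h⟩ := (hf.of_le (m := n) (by exact_mod_cast le_top)).contDiffWithinAt
    (s := univ) |>.contDiffOn' le_rfl (by simp)
  exact ⟨u, hu, hxu, by simpa using h⟩

/-- If all derivatives of `h` of order at most `n` vanish at `τ y`, then so do those of
`z ↦ g z (h (τ z))` at `y`. -/
theorem iteratedFDeriv_transport_eq_zero {h : E' → F} {τ : E → E'} {g : E → F →L[ℝ] G} {y : E}
    (hh : ContDiffAt ℝ ∞ h (τ y)) (hτ : ContDiffAt ℝ ∞ τ y) (hg : ContDiffAt ℝ ∞ g y) {n : ℕ}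
    (h0 : ∀ m ≤ n, iteratedFDeriv ℝ m h (τ y) = 0) :
    iteratedFDeriv ℝ n (fun z => g z (h (τ z))) y = 0 := by
  obtain ⟨w, hw, hyw, hhw⟩ := exists_open_contDiffOn hh n
  obtain ⟨u₁, hu₁, hyu₁, hτu⟩ := exists_open_contDiffOn hτ n
  obtain ⟨u₂, hu₂, hyu₂, hgu⟩ := exists_open_contDiffOn hg n
  have hu₃ : IsOpen (u₁ ∩ τ ⁻¹' w) := hτu.continuousOn.isOpen_inter_preimage hu₁ hw
  set u := (u₁ ∩ τ ⁻¹' w) ∩ u₂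
  have hu : IsOpen u := hu₃.inter hu₂
  have hyu : y ∈ u := ⟨⟨hyu₁, hyw⟩, hyu₂⟩
  have hτ' : ContDiffOn ℝ n τ u := hτu.mono (fun z hz => hz.1.1)
  have hg' : ContDiffOn ℝ n g u := hgu.mono (fun z hz => hz.2)
  have hmaps : MapsTo τ u w := fun z hz => hz.1.2
  have hcomp : ∀ m ≤ n, iteratedFDerivWithin ℝ m (h ∘ τ) u y = 0 := by
    intro m hm
    have := norm_iteratedFDerivWithin_comp_le (n := m) (C := 0)
      (D := 1 + ∑ i ∈ Finset.range (m + 1), ‖iteratedFDerivWithin ℝ i τ u y‖) hhw hτ'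
      (by exact_mod_cast hm) hw.uniqueDiffOn hu.uniqueDiffOn hmaps hyu
      (fun i hi => by
        rw [iteratedFDerivWithin_of_isOpen i hw hyw, h0 i (hi.trans hm), norm_zero])
      (fun i hi him => by
        have h1 : ‖iteratedFDerivWithin ℝ i τ u y‖ ≤
            ∑ i ∈ Finset.range (m + 1), ‖iteratedFDerivWithin ℝ i τ u y‖ :=
          Finset.single_le_sum (f := fun i => ‖iteratedFDerivWithin ℝ i τ u y‖)
            (fun _ _ => norm_nonneg _) (Finset.mem_range.2 (by omega))
        have h2 : (1 : ℝ) ≤ 1 + ∑ i ∈ Finset.range (m + 1), ‖iteratedFDerivWithin ℝ i τ u y‖ := by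
          have : 0 ≤ ‖iteratedFDerivWithin ℝ i τ u y‖ := norm_nonneg _
          linarith
        refine le_trans ?_ (le_self_pow₀ h2 (by omega))
        linarith)
    simpa using this
  rw [← iteratedFDerivWithin_of_isOpen n hu hyu]
  have := norm_iteratedFDerivWithin_clm_apply (n := n) hg' (hhw.comp hτ' hmaps) hu.uniqueDiffOn
    hyu le_rfl
  rw [Finset.sum_eq_zero (fun i _ => by rw [hcomp (n - i) (Nat.sub_le _ _)]; simp)] at this
  simpa using this

/-- Smooth dependence of partial derivatives on all the variables. -/
theorem contDiffAt_iteratedFDeriv_partial {Ψ : E × E' → F} {c : E → E'} {y : E} (l : ℕ)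
    (hΨ : ContDiffAt ℝ ∞ Ψ (y, c y)) (hc : ContDiffAt ℝ ∞ c y) :
    ContDiffAt ℝ ∞ (fun z => iteratedFDeriv ℝ l (fun z' => Ψ (z', c z)) z) y := by
  obtain ⟨u, hu, hyu, hΨu⟩ := exists_open_contDiffOn hΨ l
  have hpair : ContDiffAt ℝ ∞ (fun z => (z, c z)) y := contDiffAt_id.prodMk hc
  have hD : ContDiffAt ℝ ∞ (iteratedFDeriv ℝ l Ψ) (y, c y) :=
    hΨ.iteratedFDeriv_right (m := ∞) (by exact_mod_cast le_rfl)
  have hD' : ContDiffAt ℝ ∞ (fun z => iteratedFDeriv ℝ l Ψ (z, c z)) y := hD.comp y hpair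
  have hL := (ContinuousMultilinearMap.compContinuousLinearMapL (𝕜 := ℝ) (F := F)
    (fun _ : Fin l => ContinuousLinearMap.inl ℝ E E')).contDiff (n := ∞)
  refine (hL.contDiffAt.comp y hD').congr_of_eventuallyEq ?_
  filter_upwards [hpair.continuousAt.preimage_mem_nhds (hu.mem_nhds hyu)] with z hz
  have hz' : (z, c z) ∈ u := hz
  have hcont : Continuous fun p : E × E' => p + (0, c z) := by fun_prop
  set s : Set (E × E') := (fun p => p + (0, c z)) ⁻¹' u
  have hs : IsOpen s := hu.preimage hcont
  have hf : ContDiffOn ℝ l (fun p => Ψ (p + (0, c z))) s :=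
    hΨu.comp (contDiff_id.add contDiff_const).contDiffOn (fun p hp => hp)
  have hzs : ContinuousLinearMap.inl ℝ E E' z ∈ s := by simpa [s] using hz'
  have hs' : IsOpen (ContinuousLinearMap.inl ℝ E E' ⁻¹' s) :=
    hs.preimage (ContinuousLinearMap.continuous _)
  have := (ContinuousLinearMap.inl ℝ E E').iteratedFDerivWithin_comp_right hf hs.uniqueDiffOn
    hs'.uniqueDiffOn hzs (i := l) le_rfl
  rw [iteratedFDerivWithin_of_isOpen l hs' hzs, iteratedFDerivWithin_of_isOpen l hs hzs,
    iteratedFDeriv_comp_add_right] at this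
  have h1 : (fun p => Ψ (p + (0, c z))) ∘ (ContinuousLinearMap.inl ℝ E E') =
      fun z' => Ψ (z', c z) := by
    funext z'; simp
  rw [h1] at this
  rw [this]
  simp [ContinuousMultilinearMap.compContinuousLinearMapL]

end Calculus

section Model

variable (E F : Type*) [NormedAddCommGroup E] [NormedSpace ℝ E]
  [NormedAddCommGroup F] [NormedSpace ℝ F]

/-- Arrays `(a₀, …, a_r)` of symmetric `F`-valued multilinear maps on `E`, where
`a_l` plays the role of an `l`-th derivative. -/
def symmetricArrays (r : ℕ) : Submodule ℝ (∀ l : Fin (r + 1), E [×l]→L[ℝ] F) where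
  carrier := {a | ∀ (l : Fin (r + 1)) (σ : Equiv.Perm (Fin l)) (v : Fin l → E),
    a l (v ∘ σ) = a l v}
  add_mem' ha hb l σ v := by simp [ha l σ v, hb l σ v]
  zero_mem' l σ v := by simp
  smul_mem' c a ha l σ v := by simp [ha l σ v]

instance [FiniteDimensional ℝ E] [FiniteDimensional ℝ F] (l : ℕ) :
    FiniteDimensional ℝ (E [×l]→L[ℝ] F) :=
  FiniteDimensional.of_injective
    (ContinuousMultilinearMap.toMultilinearMapLinear (R' := ℝ) (A := ℝ)
      (M₁ := fun _ : Fin l => E) (M₂ := F))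
    ContinuousMultilinearMap.toMultilinearMap_injective

/-- The typical fibre of the `r`-jet bundle of a vector bundle with typical fibre `F` over a
manifold modelled on `E`. -/
def JetModel (r : ℕ) : Type _ := symmetricArrays E F r

instance (r : ℕ) : NormedAddCommGroup (JetModel E F r) :=
  inferInstanceAs (NormedAddCommGroup (symmetricArrays E F r))

instance (r : ℕ) : NormedSpace ℝ (JetModel E F r) :=
  inferInstanceAs (NormedSpace ℝ (symmetricArrays E F r))

instance [FiniteDimensional ℝ E] [FiniteDimensional ℝ F] (r : ℕ) :
    FiniteDimensional ℝ (JetModel E F r) :=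
  inferInstanceAs (FiniteDimensional ℝ (symmetricArrays E F r))

variable {E F} {r : ℕ}

/-- The derivatives of order `0, …, r` at `y` of a smooth map `f : E → F`. -/
def jetOf (r : ℕ) (f : E → F) (y : E) (hf : ContDiffAt ℝ ∞ f y) : JetModel E F r :=
  ⟨fun l => iteratedFDeriv ℝ l f y, fun l σ v =>
    iteratedFDeriv_comp_perm (hf.of_le (by exact_mod_cast le_top)) v σ⟩

/-- The polynomial map `y ↦ ∑ a_l(y, …, y) / l!` with prescribed derivatives `a` at the origin. -/
def taylor (a : JetModel E F r) (y : E) : F :=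
  ∑ l : Fin (r + 1), ((l : ℕ)! : ℝ)⁻¹ • a.1 l (fun _ => y)

theorem contDiff_taylor (a : JetModel E F r) : ContDiff ℝ ∞ (taylor a) := by
  unfold taylor
  refine ContDiff.sum fun l _ => contDiff_const.smul ?_
  exact (a.1 l).contDiff.comp (contDiff_pi.2 fun _ => contDiff_id)

theorem taylor_add (a b : JetModel E F r) (y : E) : taylor (a + b) y = taylor a y + taylor b y := by
  have h : ∀ l, (a + b).1 l = a.1 l + b.1 l := fun _ => rfl
  simp [taylor, h, Finset.sum_add_distrib]

theorem taylor_smul (c : ℝ) (a : JetModel E F r) (y : E) : taylor (c • a) y = c • taylor a y := by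
  simp only [taylor, Finset.smul_sum]
  refine Finset.sum_congr rfl fun l _ => ?_
  rw [smul_comm c]
  rfl

theorem iteratedFDeriv_taylor (a : JetModel E F r) (l : Fin (r + 1)) :
    iteratedFDeriv ℝ l (taylor a) 0 = a.1 l := by
  let p : FormalMultilinearSeries ℝ E F := fun m =>
    if h : m < r + 1 then ((m ! : ℕ) : ℝ)⁻¹ • a.1 ⟨m, h⟩ else 0
  have hpos : ∀ l : Fin (r + 1), p l = ((l : ℕ)! : ℝ)⁻¹ • a.1 l := fun l => dif_pos l.2
  have hneg : ∀ m, ¬ m < r + 1 → p m = 0 := fun m h => dif_neg h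
  have hr : p.radius = ⊤ := p.radius_eq_top_of_forall_image_add_eq_zero (r + 1) fun m =>
    hneg _ (by omega)
  have hp : HasFPowerSeriesOnBall (taylor a) p 0 ⊤ :=
    { r_le := by rw [hr]
      r_pos := by simp
      hasSum := by
        intro y _
        have hs : taylor a (0 + y) = ∑ m ∈ Finset.range (r + 1), p m (fun _ => y) := by
          rw [zero_add, taylor, ← Fin.sum_univ_eq_sum_range (fun m => p m (fun _ => y))]
          refine Finset.sum_congr rfl fun l _ => ?_
          rw [hpos]
          rfl
        rw [hs]
        refine hasSum_sum_of_ne_finset_zero fun m hm => ?_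
        have : ¬ m < r + 1 := by simpa using hm
        rw [hneg m this]
        rfl }
  have hω : AnalyticOn ℝ (taylor a) univ := by
    have : ContDiff ℝ ω (taylor a) := by
      unfold taylor
      refine ContDiff.sum fun l _ => contDiff_const.smul ?_
      exact (a.1 l).contDiff.comp (contDiff_pi.2 fun _ => contDiff_id)
    exact this.contDiffOn.analyticOn
  ext v
  rw [hp.iteratedFDeriv_eq_sum hω]
  have : ∀ σ : Equiv.Perm (Fin l), p l (fun i => v (σ i)) = ((l : ℕ)! : ℝ)⁻¹ • a.1 l v := by
    intro σ
    rw [hpos]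
    exact congrArg (fun w => ((l : ℕ)! : ℝ)⁻¹ • w) (a.2 l σ v)
  simp only [this, Finset.sum_const, Finset.card_univ, Fintype.card_perm, Fintype.card_fin]
  rw [← Nat.cast_smul_eq_nsmul ℝ, smul_smul, mul_inv_cancel₀ (by positivity), one_smul]

theorem jetOf_congr {f g : E → F} {y : E} (hf : ContDiffAt ℝ ∞ f y) (hg : ContDiffAt ℝ ∞ g y)
    (h : f =ᶠ[𝓝 y] g) : jetOf r f y hf = jetOf r g y hg := by
  apply Subtype.ext
  funext l
  exact (h.iteratedFDeriv ℝ l).eq_of_nhds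

theorem contDiffAt_taylor_comp {E' : Type*} [NormedAddCommGroup E'] [NormedSpace ℝ E']
    {τ : E → E'} {y : E} (a : JetModel E' F r) (hτ : ContDiffAt ℝ ∞ τ y) (c : E') :
    ContDiffAt ℝ ∞ (fun z => taylor a (τ z - c)) y :=
  (contDiff_taylor a).contDiffAt.comp y (hτ.sub contDiffAt_const)

/-- The `r`-jet of `z ↦ g z (f (τ z))` depends on `f` only through its `r`-jet. -/
theorem jetOf_transport {G : Type*} [NormedAddCommGroup G] [NormedSpace ℝ G]
    {f : E → F} {τ : E → E} {g : E → F →L[ℝ] G} {y : E}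
    (hf : ContDiffAt ℝ ∞ f (τ y)) (hτ : ContDiffAt ℝ ∞ τ y) (hg : ContDiffAt ℝ ∞ g y) :
    jetOf r (fun z => g z (taylor (jetOf r f (τ y) hf) (τ z - τ y))) y
      (hg.clm_apply (contDiffAt_taylor_comp _ hτ _)) =
    jetOf r (fun z => g z (f (τ z))) y (hg.clm_apply (hf.comp y hτ)) := by
  set a := jetOf r f (τ y) hf with ha
  have h1 : ContDiffAt ℝ ∞ (fun w => taylor a (w - τ y)) (τ y) :=
    contDiffAt_taylor_comp a contDiffAt_id _
  have hz : ∀ m ≤ r, iteratedFDeriv ℝ m (fun w => taylor a (w - τ y) - f w) (τ y) = 0 := by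
    intro m hm
    have hle : ((m : ℕ) : WithTop ℕ∞) ≤ (∞ : WithTop ℕ∞) := by exact_mod_cast le_top
    rw [show (fun w => taylor a (w - τ y) - f w) = (fun w => taylor a (w - τ y)) - f from rfl,
      iteratedFDeriv_sub_apply (h1.of_le hle) (hf.of_le hle),
      show (fun w => taylor a (w - τ y)) = fun w => taylor a (w - τ y) from rfl,
      iteratedFDeriv_comp_sub]
    have := iteratedFDeriv_taylor a ⟨m, by omega⟩
    simp only [sub_self, this]
    simp [ha, jetOf]
  apply Subtype.ext
  funext l
  have hle : ((l : ℕ) : WithTop ℕ∞) ≤ (∞ : WithTop ℕ∞) := by exact_mod_cast le_top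
  have := iteratedFDeriv_transport_eq_zero (n := l) (h1.sub hf) hτ hg
    (fun m hm => hz m (by omega))
  have h2 : ContDiffAt ℝ ∞ (fun z => g z (taylor a (τ z - τ y))) y :=
    hg.clm_apply (contDiffAt_taylor_comp _ hτ _)
  have h3 : ContDiffAt ℝ ∞ (fun z => g z (f (τ z))) y := hg.clm_apply (hf.comp y hτ)
  rw [show (fun z => g z (taylor a (τ z - τ y) - f (τ z))) =
    (fun z => g z (taylor a (τ z - τ y))) - fun z => g z (f (τ z)) by
      funext z; simp, iteratedFDeriv_sub_apply (h2.of_le hle) (h3.of_le hle)] at this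
  exact sub_eq_zero.1 this

theorem contDiffAt_jetModel [FiniteDimensional ℝ E] [FiniteDimensional ℝ F]
    {f : E → JetModel E F r} {y : E}
    (hf : ∀ l, ContDiffAt ℝ ∞ (fun z => (f z).1 l) y) : ContDiffAt ℝ ∞ f y := by
  obtain ⟨P, hP⟩ := LinearMap.exists_leftInverse_of_injective (symmetricArrays E F r).subtype
    (Submodule.ker_subtype _)
  let P' : (∀ l : Fin (r + 1), E [×l]→L[ℝ] F) →L[ℝ] JetModel E F r :=
    LinearMap.toContinuousLinearMap P
  have h := P'.contDiff.contDiffAt.comp y (contDiffAt_pi.2 hf)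
  refine h.congr_of_eventuallyEq (Eventually.of_forall fun z => ?_)
  exact (LinearMap.congr_fun hP (f z)).symm

theorem contDiffAt_clm_of_apply {D A B : Type*} [NormedAddCommGroup D] [NormedSpace ℝ D]
    [NormedAddCommGroup A] [NormedSpace ℝ A] [NormedAddCommGroup B] [NormedSpace ℝ B]
    [FiniteDimensional ℝ A] {f : D → A →L[ℝ] B} {y : D}
    (hf : ∀ a, ContDiffAt ℝ ∞ (fun z => f z a) y) : ContDiffAt ℝ ∞ f y := by
  let e₁ := ContinuousLinearEquiv.ofFinrankEq (Module.finrank_fin_fun ℝ (n := Module.finrank ℝ A)).symm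
  let e₂ := (e₁.arrowCongr (1 : B ≃L[ℝ] B)).trans
    (ContinuousLinearEquiv.piRing (Fin (Module.finrank ℝ A)))
  rw [← Function.id_comp f, ← e₂.symm_comp_self]
  exact e₂.symm.contDiff.contDiffAt.comp y (contDiffAt_pi.mpr fun i => hf _)

end Model

section JetBundle

variable {E F X : Type*} [NormedAddCommGroup E] [NormedSpace ℝ E]
  [NormedAddCommGroup F] [NormedSpace ℝ F]
  [TopologicalSpace X] [ChartedSpace E X]
  {W : X → Type*} [TopologicalSpace (TotalSpace F W)] [∀ x, TopologicalSpace (W x)]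
  [∀ x, AddCommGroup (W x)] [∀ x, Module ℝ (W x)] [FiberBundle F W] [VectorBundle ℝ F W]

variable (E F W) in
/-- Adapted coordinates for a vector bundle `W` over `X`: a smooth chart of `X` together with a
local trivialization of `W`. -/
structure AdaptedChart where
  /-- the chart of the base manifold -/
  chart : OpenPartialHomeomorph X E
  chart_mem : chart ∈ IsManifold.maximalAtlas 𝓘(ℝ, E) ∞ X
  /-- the local trivialization of the vector bundle -/
  triv : Trivialization F (π F W)
  triv_mem : MemTrivializationAtlas triv

attribute [instance] AdaptedChart.triv_mem

namespace AdaptedChart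

/-- The domain of an adapted coordinate system. -/
def dom (i : AdaptedChart E F W) : Set X := i.chart.source ∩ i.triv.baseSet

theorem isOpen_dom (i : AdaptedChart E F W) : IsOpen i.dom :=
  i.chart.open_source.inter i.triv.open_baseSet

/-- The map `E → F` representing a section of `W` in an adapted coordinate system. -/
def repr (i : AdaptedChart E F W) (s : ∀ x, W x) (y : E) : F :=
  (i.triv ⟨i.chart.symm y, s (i.chart.symm y)⟩).2

/-- The change of coordinates on the base. -/
def baseChange (i j : AdaptedChart E F W) (y : E) : E := i.chart (j.chart.symm y)

/-- The change of frame, in terms of the coordinates of the second system. -/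
def frameChange (i j : AdaptedChart E F W) (y : E) : F →L[ℝ] F :=
  i.triv.coordChangeL ℝ j.triv (j.chart.symm y)

variable [IsManifold 𝓘(ℝ, E) ∞ X]

variable (F W) in
/-- The preferred adapted coordinates at a point. -/
def at' (x : X) : AdaptedChart E F W where
  chart := chartAt E x
  chart_mem := IsManifold.chart_mem_maximalAtlas x
  triv := trivializationAt F W x
  triv_mem := inferInstance

theorem mem_dom_at' (x : X) : x ∈ (at' F W x : AdaptedChart E F W).dom :=
  ⟨mem_chart_source E x, mem_baseSet_trivializationAt F W x⟩

theorem contDiffAt_symm (i : AdaptedChart E F W) {x : X} (hx : x ∈ i.chart.source) :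
    ContMDiffAt 𝓘(ℝ, E) 𝓘(ℝ, E) ∞ i.chart.symm (i.chart x) :=
  (contMDiffOn_symm_of_mem_maximalAtlas i.chart_mem).contMDiffAt
    (i.chart.open_target.mem_nhds (i.chart.map_source hx))

theorem contDiffAt_baseChange (i j : AdaptedChart E F W) {x : X} (hi : x ∈ i.dom)
    (hj : x ∈ j.dom) : ContDiffAt ℝ ∞ (baseChange i j) (j.chart x) := by
  rw [← contMDiffAt_iff_contDiffAt]
  have h1 := j.contDiffAt_symm hj.1
  have h2 : ContMDiffAt 𝓘(ℝ, E) 𝓘(ℝ, E) ∞ i.chart (j.chart.symm (j.chart x)) := by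
    rw [j.chart.left_inv hj.1]
    exact contMDiffAt_of_mem_maximalAtlas i.chart_mem hi.1
  exact h2.comp _ h1

theorem baseChange_apply (i j : AdaptedChart E F W) {x : X} (hj : x ∈ j.dom) :
    baseChange i j (j.chart x) = i.chart x := by
  rw [baseChange, j.chart.left_inv hj.1]

variable [ContMDiffVectorBundle ∞ F W 𝓘(ℝ, E)]

theorem contDiffAt_frameChange (i j : AdaptedChart E F W) {x : X} (hi : x ∈ i.dom)
    (hj : x ∈ j.dom) : ContDiffAt ℝ ∞ (frameChange i j) (j.chart x) := by
  rw [← contMDiffAt_iff_contDiffAt]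
  have h1 := j.contDiffAt_symm hj.1
  have h2 : ContMDiffAt 𝓘(ℝ, E) 𝓘(ℝ, F →L[ℝ] F) ∞
      (fun x => (i.triv.coordChangeL ℝ j.triv x : F →L[ℝ] F)) (j.chart.symm (j.chart x)) := by
    rw [j.chart.left_inv hj.1]
    exact (contMDiffOn_coordChangeL (IB := 𝓘(ℝ, E)) (n := ∞) i.triv j.triv).contMDiffAt
      ((i.triv.open_baseSet.inter j.triv.open_baseSet).mem_nhds ⟨hi.2, hj.2⟩)
  exact h2.comp _ h1

variable {r : ℕ}

theorem contDiffAt_change (i j : AdaptedChart E F W) {x : X} (hi : x ∈ i.dom) (hj : x ∈ j.dom)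
    (a : JetModel E F r) : ContDiffAt ℝ ∞
      (fun z => frameChange i j z (taylor a (baseChange i j z - i.chart x))) (j.chart x) :=
  (contDiffAt_frameChange i j hi hj).clm_apply
    (contDiffAt_taylor_comp a (contDiffAt_baseChange i j hi hj) _)

variable [FiniteDimensional ℝ E] [FiniteDimensional ℝ F]

open Classical in
/-- The transformation rule for the components of `r`-jets: represent the jet at `x` by a
polynomial section in the first coordinate system, and differentiate the representative of this
section in the second coordinate system. -/
def jetChange (r : ℕ) (i j : AdaptedChart E F W) (x : X) : JetModel E F r →L[ℝ] JetModel E F r :=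
  if h : x ∈ i.dom ∩ j.dom then
    LinearMap.toContinuousLinearMap
      { toFun a := jetOf r (fun z => frameChange i j z (taylor a (baseChange i j z - i.chart x)))
          (j.chart x) (contDiffAt_change i j h.1 h.2 a)
        map_add' a b := by
          have hle : ∀ l : Fin (r + 1), ((l : ℕ) : WithTop ℕ∞) ≤ (∞ : WithTop ℕ∞) :=
            fun l => by exact_mod_cast le_top
          apply Subtype.ext
          funext l
          have := iteratedFDeriv_add_apply ((contDiffAt_change i j h.1 h.2 a).of_le (hle l))
            ((contDiffAt_change i j h.1 h.2 b).of_le (hle l))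
          refine Eq.trans ?_ this
          simp only [jetOf]
          congr 1
          funext z
          simp [taylor_add]
        map_smul' c a := by
          have hle : ∀ l : Fin (r + 1), ((l : ℕ) : WithTop ℕ∞) ≤ (∞ : WithTop ℕ∞) :=
            fun l => by exact_mod_cast le_top
          apply Subtype.ext
          funext l
          have := iteratedFDeriv_const_smul_apply (a := c)
            ((contDiffAt_change i j h.1 h.2 a).of_le (hle l))
          refine Eq.trans ?_ this
          simp only [jetOf]
          congr 1
          funext z
          simp [taylor_smul] }
  else 0

theorem jetChange_apply (i j : AdaptedChart E F W) {x : X} (hi : x ∈ i.dom) (hj : x ∈ j.dom)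
    (a : JetModel E F r) : jetChange r i j x a =
      jetOf r (fun z => frameChange i j z (taylor a (baseChange i j z - i.chart x)))
        (j.chart x) (contDiffAt_change i j hi hj a) := by
  rw [jetChange, dif_pos ⟨hi, hj⟩]
  rfl

/-- Components of jets of functions obey the transformation rule. -/
theorem jetChange_jetOf (i j : AdaptedChart E F W) {x : X} (hi : x ∈ i.dom) (hj : x ∈ j.dom)
    {f : E → F} (hf : ContDiffAt ℝ ∞ f (i.chart x)) :
    jetChange r i j x (jetOf r f (i.chart x) hf) =
      jetOf r (fun z => frameChange i j z (f (baseChange i j z))) (j.chart x)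
        ((contDiffAt_frameChange i j hi hj).clm_apply (ContDiffAt.comp _
          (by rwa [baseChange_apply i j hj]) (contDiffAt_baseChange i j hi hj))) := by
  rw [jetChange_apply i j hi hj]
  have hb := baseChange_apply i j hj
  have hf' : ContDiffAt ℝ ∞ f (baseChange i j (j.chart x)) := by rwa [hb]
  have := jetOf_transport (r := r) hf' (contDiffAt_baseChange i j hi hj)
    (contDiffAt_frameChange i j hi hj)
  rw [← this]
  have h2 : jetOf r f (baseChange i j (j.chart x)) hf' = jetOf r f (i.chart x) hf := by
    congr 1
  simp only [hb]

theorem eventually_dom (i j : AdaptedChart E F W) {x : X} (hi : x ∈ i.dom) (hj : x ∈ j.dom) :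
    ∀ᶠ z in 𝓝 (j.chart x), z ∈ j.chart.target ∧ j.chart.symm z ∈ i.dom ∧ j.chart.symm z ∈ j.dom := by
  have h1 := (j.contDiffAt_symm hj.1).continuousAt
  have h2 : i.dom ∩ j.dom ∈ 𝓝 (j.chart.symm (j.chart x)) := by
    rw [j.chart.left_inv hj.1]
    exact (i.isOpen_dom.inter j.isOpen_dom).mem_nhds ⟨hi, hj⟩
  filter_upwards [j.chart.open_target.mem_nhds (j.chart.map_source hj.1), h1.preimage_mem_nhds h2]
    with z hz hz'
  exact ⟨hz, hz'⟩

theorem jetChange_self (i : AdaptedChart E F W) {x : X} (hi : x ∈ i.dom) (a : JetModel E F r) :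
    jetChange r i i x a = a := by
  have h1 : ContDiffAt ℝ ∞ (fun z => taylor a (z - i.chart x)) (i.chart x) :=
    contDiffAt_taylor_comp a contDiffAt_id _
  rw [jetChange_apply i i hi hi]
  trans jetOf r (fun z => taylor a (z - i.chart x)) (i.chart x) h1
  · apply jetOf_congr
    filter_upwards [eventually_dom i i hi hi] with z hz
    rw [baseChange, i.chart.right_inv hz.1, frameChange]
    exact i.triv.coordChangeL_apply' i.triv ⟨hz.2.1.2, hz.2.1.2⟩ _ |>.trans (by
      rw [i.triv.apply_symm_apply' hz.2.1.2])
  · apply Subtype.ext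
    funext l
    simp only [jetOf]
    rw [iteratedFDeriv_comp_sub, sub_self, iteratedFDeriv_taylor]

theorem jetChange_comp (i j k : AdaptedChart E F W) {x : X} (hi : x ∈ i.dom) (hj : x ∈ j.dom)
    (hk : x ∈ k.dom) (a : JetModel E F r) :
    jetChange r j k x (jetChange r i j x a) = jetChange r i k x a := by
  rw [jetChange_apply i j hi hj, jetChange_jetOf j k hj hk, jetChange_apply i k hi hk]
  apply jetOf_congr
  filter_upwards [eventually_dom j k hj hk, eventually_dom i k hi hk] with z hz hz'
  have h1 : j.chart.symm (baseChange j k z) = k.chart.symm z := j.chart.left_inv hz.2.1.1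
  rw [frameChange, frameChange, frameChange, h1]
  have h2 : baseChange i j (baseChange j k z) = baseChange i k z := by
    rw [baseChange, h1]; rfl
  rw [h2]
  generalize taylor a (baseChange i k z - i.chart x) = v
  have hi' := hz'.2.1.2
  have hj' := hz.2.1.2
  have hk' := hz.2.2.2
  simp only [ContinuousLinearEquiv.coe_coe]
  rw [Trivialization.coordChangeL_apply _ _ ⟨hj', hk'⟩, Trivialization.coordChangeL_apply _ _ ⟨hi', hj'⟩,
    Trivialization.coordChangeL_apply _ _ ⟨hi', hk'⟩]
  rw [j.triv.symm_apply_apply_mk hj']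

theorem contMDiffOn_jetChange (i j : AdaptedChart E F W) :
    ContMDiffOn 𝓘(ℝ, E) 𝓘(ℝ, JetModel E F r →L[ℝ] JetModel E F r) ∞ (jetChange r i j)
      (i.dom ∩ j.dom) := by
  intro x hx
  apply ContMDiffAt.contMDiffWithinAt
  have hi := hx.1
  have hj := hx.2
  have hj1 : ContMDiffAt 𝓘(ℝ, E) 𝓘(ℝ, E) ∞ j.chart x :=
    contMDiffAt_of_mem_maximalAtlas j.chart_mem hj.1
  -- the coordinate expression of the transition functions
  have hcoord : ContDiffAt ℝ ∞ (fun y => jetChange r i j (j.chart.symm y)) (j.chart x) := by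
    refine contDiffAt_clm_of_apply fun a => contDiffAt_jetModel fun l => ?_
    have hΨ : ContDiffAt ℝ ∞ (fun p : E × E => frameChange i j p.1
        (taylor a (baseChange i j p.1 - p.2))) (j.chart x, baseChange i j (j.chart x)) := by
      have h1 : ContDiffAt ℝ ∞ (fun p : E × E => frameChange i j p.1)
          (j.chart x, baseChange i j (j.chart x)) :=
        ContDiffAt.comp (g := frameChange i j) (f := Prod.fst)
          (j.chart x, baseChange i j (j.chart x)) (contDiffAt_frameChange i j hi hj) contDiffAt_fst
      have h2 : ContDiffAt ℝ ∞ (fun p : E × E => baseChange i j p.1)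
          (j.chart x, baseChange i j (j.chart x)) :=
        ContDiffAt.comp (g := baseChange i j) (f := Prod.fst)
          (j.chart x, baseChange i j (j.chart x)) (contDiffAt_baseChange i j hi hj) contDiffAt_fst
      exact h1.clm_apply ((contDiff_taylor a).contDiffAt.comp _ (h2.sub contDiffAt_snd))
    have := contDiffAt_iteratedFDeriv_partial l hΨ (contDiffAt_baseChange i j hi hj)
    refine this.congr_of_eventuallyEq ?_
    filter_upwards [eventually_dom i j hi hj] with z hz
    rw [jetChange_apply i j hz.2.1 hz.2.2]
    simp only [jetOf, j.chart.right_inv hz.1]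
    rfl
  have := (contMDiffAt_iff_contDiffAt.2 hcoord).comp x hj1
  refine this.congr_of_eventuallyEq ?_
  filter_upwards [j.chart.open_source.mem_nhds hj.1] with z hz
  simp [j.chart.left_inv hz]

end AdaptedChart

variable [IsManifold 𝓘(ℝ, E) ∞ X] [ContMDiffVectorBundle ∞ F W 𝓘(ℝ, E)]
  [FiniteDimensional ℝ E] [FiniteDimensional ℝ F]

variable (E F W) in
/-- The `r`-jet bundle of the vector bundle `W`, described through the transformation rule of the
components of jets in adapted coordinates. -/
def jetCore (r : ℕ) : VectorBundleCore ℝ X (JetModel E F r) (AdaptedChart E F W) where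
  baseSet := AdaptedChart.dom
  isOpen_baseSet := AdaptedChart.isOpen_dom
  indexAt := AdaptedChart.at' F W
  mem_baseSet_at := AdaptedChart.mem_dom_at'
  coordChange := AdaptedChart.jetChange r
  coordChange_self i _ hx a := AdaptedChart.jetChange_self i hx a
  continuousOn_coordChange i j := (AdaptedChart.contMDiffOn_jetChange i j).continuousOn
  coordChange_comp i j k _ hx a := AdaptedChart.jetChange_comp i j k hx.1.1 hx.1.2 hx.2 a

instance (r : ℕ) : (jetCore E F W r).IsContMDiff 𝓘(ℝ, E) ∞ where
  contMDiffOn_coordChange := AdaptedChart.contMDiffOn_jetChange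

variable (E F W) in
/-- The fibre at `x` of the `r`-jet bundle `J^r W`. A jet is recorded by its components in the
preferred adapted coordinates at `x`. -/
def Jet (r : ℕ) (x : X) : Type _ := (jetCore E F W r).Fiber x

instance (r : ℕ) (x : X) : NormedAddCommGroup (Jet E F W r x) :=
  inferInstanceAs (NormedAddCommGroup (JetModel E F r))
instance (r : ℕ) (x : X) : NormedSpace ℝ (Jet E F W r x) :=
  inferInstanceAs (NormedSpace ℝ (JetModel E F r))
instance (r : ℕ) (x : X) : FiniteDimensional ℝ (Jet E F W r x) :=
  inferInstanceAs (FiniteDimensional ℝ (JetModel E F r))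
instance (r : ℕ) : TopologicalSpace (TotalSpace (JetModel E F r) (Jet E F W r)) :=
  inferInstanceAs (TopologicalSpace (jetCore E F W r).TotalSpace)
instance (r : ℕ) : FiberBundle (JetModel E F r) (Jet E F W r) :=
  inferInstanceAs (FiberBundle (JetModel E F r) (jetCore E F W r).Fiber)
instance (r : ℕ) : VectorBundle ℝ (JetModel E F r) (Jet E F W r) :=
  inferInstanceAs (VectorBundle ℝ (JetModel E F r) (jetCore E F W r).Fiber)
instance (r : ℕ) : ContMDiffVectorBundle ∞ (JetModel E F r) (Jet E F W r) 𝓘(ℝ, E) :=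
  inferInstanceAs (ContMDiffVectorBundle ∞ (JetModel E F r) (jetCore E F W r).Fiber 𝓘(ℝ, E))

theorem AdaptedChart.contDiffAt_repr (i : AdaptedChart E F W) {x : X} (hx : x ∈ i.dom)
    (s : Cₛ^∞⟮𝓘(ℝ, E); F, W⟯) : ContDiffAt ℝ ∞ (i.repr s) (i.chart x) := by
  rw [← contMDiffAt_iff_contDiffAt]
  have h1 := i.contDiffAt_symm hx.1
  have h2 : ContMDiffAt 𝓘(ℝ, E) 𝓘(ℝ, F) ∞ (fun y => (i.triv ⟨y, s y⟩).2)
      (i.chart.symm (i.chart x)) := by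
    rw [i.chart.left_inv hx.1]
    exact (i.triv.contMDiffAt_section_iff hx.2).1 (s.contMDiff x)
  exact h2.comp _ h1

namespace Jet

variable {r : ℕ}

variable (r) in
/-- The `r`-jet at `x` of a smooth section: all derivatives of order at most `r` at `x` of the
representative of the section in the preferred adapted coordinates at `x`. -/
def jet (s : Cₛ^∞⟮𝓘(ℝ, E); F, W⟯) (x : X) : Jet E F W r x :=
  jetOf r ((AdaptedChart.at' F W x).repr s) (chartAt E x x)
    ((AdaptedChart.at' F W x).contDiffAt_repr (AdaptedChart.mem_dom_at' x) s)

/-- The local trivialization of the jet bundle induced by adapted coordinates. -/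
def triv (r : ℕ) (i : AdaptedChart E F W) :
    Trivialization (JetModel E F r) (π (JetModel E F r) (Jet E F W r)) :=
  (jetCore E F W r).localTriv i

instance (r : ℕ) (i : AdaptedChart E F W) : MemTrivializationAtlas (triv r i) := ⟨⟨i, rfl⟩⟩

/-- The components of a jet in adapted coordinates. -/
def coord (i : AdaptedChart E F W) {x : X} (A : Jet E F W r x) : JetModel E F r :=
  (triv r i ⟨x, A⟩).2

/-- In arbitrary adapted coordinates, the components of the jet of a section are the derivatives
of the representative of the section. -/
theorem coord_jet (i : AdaptedChart E F W) {x : X} (hx : x ∈ i.dom)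
    (s : Cₛ^∞⟮𝓘(ℝ, E); F, W⟯) :
    coord i (jet r s x) = jetOf r (i.repr s) (i.chart x) (i.contDiffAt_repr hx s) := by
  set j : AdaptedChart E F W := AdaptedChart.at' F W x with hj
  have h0 : x ∈ j.dom := AdaptedChart.mem_dom_at' (E := E) (F := F) (W := W) x
  change AdaptedChart.jetChange r j i x
    (jetOf r (j.repr s) (j.chart x) (j.contDiffAt_repr h0 s)) = _
  rw [AdaptedChart.jetChange_jetOf _ _ h0 hx]
  apply jetOf_congr
  filter_upwards [AdaptedChart.eventually_dom j i h0 hx] with z hz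
  have h1 : j.chart.symm (AdaptedChart.baseChange j i z) = i.chart.symm z :=
    j.chart.left_inv hz.2.1.1
  have h2 : j.repr s (AdaptedChart.baseChange j i z) =
      (j.triv ⟨i.chart.symm z, s (i.chart.symm z)⟩).2 := by
    rw [AdaptedChart.repr, h1]
  rw [AdaptedChart.frameChange, h2]
  simp only [ContinuousLinearEquiv.coe_coe]
  rw [Trivialization.coordChangeL_apply _ _ ⟨hz.2.1.2, hz.2.2.2⟩,
    j.triv.symm_apply_apply_mk hz.2.1.2, AdaptedChart.repr]

/-- The smooth section `j^r s` of the jet bundle, the jet extension of a smooth section `s`. -/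
def jetSection (r : ℕ) (s : Cₛ^∞⟮𝓘(ℝ, E); F, W⟯) :
    Cₛ^∞⟮𝓘(ℝ, E); JetModel E F r, Jet E F W r⟯ where
  toFun := jet r s
  contMDiff_toFun := by
    intro x
    set i := (AdaptedChart.at' F W x : AdaptedChart E F W)
    have hx : x ∈ i.dom := AdaptedChart.mem_dom_at' x
    have hi : ContMDiffAt 𝓘(ℝ, E) 𝓘(ℝ, E) ∞ i.chart x :=
      contMDiffAt_of_mem_maximalAtlas i.chart_mem hx.1
    refine (Trivialization.contMDiffAt_section_iff (s := jet r s) (triv r i) hx).2 ?_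
    have h : ContDiffAt ℝ ∞ (fun y => coord i (jet r s (i.chart.symm y))) (i.chart x) := by
      refine contDiffAt_jetModel fun l => ?_
      have := (i.contDiffAt_repr hx s).iteratedFDeriv_right (m := ∞) (i := l)
        (by exact_mod_cast le_rfl)
      refine this.congr_of_eventuallyEq ?_
      filter_upwards [AdaptedChart.eventually_dom i i hx hx] with z hz
      rw [coord_jet i hz.2.1]
      simp only [jetOf, i.chart.right_inv hz.1]
    refine ((contMDiffAt_iff_contDiffAt.2 h).comp x hi).congr_of_eventuallyEq ?_
    filter_upwards [i.chart.open_source.mem_nhds hx.1] with z hz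
    rw [Function.comp_apply, i.chart.left_inv hz]
    rfl

/-- The natural projection `J^r W → W`, `j^r s (x) ↦ s x`. -/
def toBase (x : X) : Jet E F W r x →ₗ[ℝ] W x :=
  ((trivializationAt F W x).symmL ℝ x).toLinearMap ∘ₗ
    { toFun a := a.1 0 (fun _ => 0)
      map_add' _ _ := rfl
      map_smul' _ _ := rfl : JetModel E F r →ₗ[ℝ] F }

theorem toBase_jet (s : Cₛ^∞⟮𝓘(ℝ, E); F, W⟯) (x : X) : toBase x (jet r s x) = s x := by
  change (trivializationAt F W x).symmL ℝ x ((AdaptedChart.at' F W x).repr s (chartAt E x x)) = s x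
  rw [AdaptedChart.repr]
  change (trivializationAt F W x).symmL ℝ x (trivializationAt F W x
    ⟨(chartAt E x).symm (chartAt E x x), s ((chartAt E x).symm (chartAt E x x))⟩).2 = s x
  rw [(chartAt E x).left_inv (mem_chart_source E x)]
  rw [Trivialization.symmL_apply _ (mem_baseSet_trivializationAt F W x)]
  exact (trivializationAt F W x).symm_apply_apply_mk (mem_baseSet_trivializationAt F W x) (s x)

variable (E F W r) in
/-- The fibre at `x` of the vertical subbundle `V⁰J^r W`, the kernel of `J^r W → W`. -/
def vertical (x : X) : Submodule ℝ (Jet E F W r x) := LinearMap.ker (toBase x)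

end Jet

/-- The adapted coordinates of `J^r W` induced by adapted coordinates of `W`. -/
def AdaptedChart.prolong (r : ℕ) (i : AdaptedChart E F W) :
    AdaptedChart E (JetModel E F r) (Jet E F W r) where
  chart := i.chart
  chart_mem := i.chart_mem
  triv := Jet.triv r i
  triv_mem := inferInstance

end JetBundle

section Algebra

variable (T U L : Type*) [AddCommGroup T] [Module ℝ T] [TopologicalSpace T]
  [AddCommGroup U] [Module ℝ U] [TopologicalSpace U] [IsTopologicalAddGroup U]
  [ContinuousSMul ℝ U] [AddCommGroup L] [Module ℝ L]

/-- The linear map `T ⊗ U* ⊗ L → L(L(T, U), L)`, `v ⊗ g ⊗ θ ↦ (A ↦ g (A v) θ)`. -/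
def tensorToHom :
    TensorProduct ℝ T (TensorProduct ℝ (U →L[ℝ] ℝ) L) →ₗ[ℝ] ((T →L[ℝ] U) →ₗ[ℝ] L) :=
  TensorProduct.lift <|
    (TensorProduct.uncurry (RingHom.id ℝ) (U →L[ℝ] ℝ) L ((T →L[ℝ] U) →ₗ[ℝ] L)) ∘ₗ
      LinearMap.mk₂ ℝ (fun v g => LinearMap.mk₂ ℝ (fun θ A => g (A v) • θ)
          (fun _ _ _ => smul_add _ _ _) (fun _ _ _ => smul_comm _ _ _)
          (fun _ _ _ => by simp [add_smul]) (fun _ _ _ => by simp [mul_smul]))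
        (fun _ _ _ => by ext; simp [add_smul]) (fun _ _ _ => by ext; simp [mul_smul])
        (fun _ _ _ => by ext; simp [add_smul]) (fun _ _ _ => by ext; simp [mul_smul])

variable {T U L} in
@[simp]
theorem tensorToHom_tmul (v : T) (g : U →L[ℝ] ℝ) (θ : L) (A : T →L[ℝ] U) :
    tensorToHom T U L (v ⊗ₜ (g ⊗ₜ θ)) A = g (A v) • θ := rfl

variable {T L} (M : Type*) [AddCommGroup M] [Module ℝ M]

/-- The linear map `T ⊗ U* ⊗ L → L(U, M)`, `v ⊗ g ⊗ θ ↦ (u ↦ g u • c(v, θ))`, induced by a bilinear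
map `c : T × L → M`. -/
def tensorContract (c : T →ₗ[ℝ] L →ₗ[ℝ] M) :
    TensorProduct ℝ T (TensorProduct ℝ (U →L[ℝ] ℝ) L) →ₗ[ℝ] (U →ₗ[ℝ] M) :=
  TensorProduct.lift <|
    (TensorProduct.uncurry (RingHom.id ℝ) (U →L[ℝ] ℝ) L (U →ₗ[ℝ] M)) ∘ₗ
      LinearMap.mk₂ ℝ (fun v g => LinearMap.mk₂ ℝ (fun θ u => g u • c v θ)
          (fun _ _ _ => by simp) (fun _ _ _ => by rw [map_smul, smul_comm])
          (fun _ _ _ => by simp [add_smul]) (fun _ _ _ => by simp [mul_smul]))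
        (fun _ _ _ => by ext; simp)
        (fun r v g => LinearMap.ext fun θ => LinearMap.ext fun u => by
          change g u • c (r • v) θ = r • g u • c v θ
          rw [map_smul, LinearMap.smul_apply, smul_comm])
        (fun _ _ _ => by ext; simp [add_smul]) (fun _ _ _ => by ext; simp [mul_smul])

variable {U M} in
@[simp]
theorem tensorContract_tmul (c : T →ₗ[ℝ] L →ₗ[ℝ] M) (v : T) (g : U →L[ℝ] ℝ) (θ : L) (u : U) :
    tensorContract U M c (v ⊗ₜ (g ⊗ₜ θ)) u = g u • c v θ := rfl

end Algebra

section Stress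

/-- The model space `ℝⁿ`. -/
abbrev Coord (n : ℕ) : Type := EuclideanSpace ℝ (Fin n)

/-- The space `⋀^p T_x^*X` of alternating `p`-forms at `x`. -/
abbrev Form (E : Type*) [NormedAddCommGroup E] [NormedSpace ℝ E] {X : Type*} [TopologicalSpace X]
    [ChartedSpace E X] (p : ℕ) (x : X) : Type _ :=
  TangentSpace 𝓘(ℝ, E) x [⋀^Fin p]→L[ℝ] Bundle.Trivial X ℝ x

section

variable {E X : Type*} [NormedAddCommGroup E] [NormedSpace ℝ E]
  [TopologicalSpace X] [ChartedSpace E X]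

/-- The interior product `(v, θ) ↦ v ⌟ θ = θ(v, ·, …, ·)`. -/
def interiorProd {d : ℕ} :
    E →ₗ[ℝ] (E [⋀^Fin (d + 1)]→L[ℝ] ℝ) →ₗ[ℝ] (E [⋀^Fin d]→L[ℝ] ℝ) :=
  LinearMap.mk₂ ℝ (fun v θ => θ.curryLeft v) (fun v w θ => by simp) (fun c v θ => by simp)
    (fun v θ η => by ext; simp) (fun c v θ => by ext; simp)

variable (E) in
/-- The interior product `(v, θ) ↦ v ⌟ θ` at a point of a manifold. -/
def contract {d : ℕ} (x : X) :
    TangentSpace 𝓘(ℝ, E) x →ₗ[ℝ] Form E (d + 1) x →ₗ[ℝ] Form E d x :=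
  interiorProd (E := E)

end

variable {E F X : Type*} [NormedAddCommGroup E] [NormedSpace ℝ E]
  [NormedAddCommGroup F] [NormedSpace ℝ F]
  [TopologicalSpace X] [ChartedSpace E X]
  {W : X → Type*} [TopologicalSpace (TotalSpace F W)] [∀ x, TopologicalSpace (W x)]
  [∀ x, AddCommGroup (W x)] [∀ x, Module ℝ (W x)] [FiberBundle F W] [VectorBundle ℝ F W]
  [IsManifold 𝓘(ℝ, E) ∞ X] [ContMDiffVectorBundle ∞ F W 𝓘(ℝ, E)]
  [FiniteDimensional ℝ E] [FiniteDimensional ℝ F]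
  [∀ x, IsTopologicalAddGroup (W x)] [∀ x, ContinuousSMul ℝ (W x)]

/-- The condition that characterizes the natural isomorphism `L(T_xX, W_x) ≅ V⁰J¹W`: if the smooth
function `f` vanishes at `x`, then `df_x ⊗ s(x)` corresponds to the jet at `x` of `f s`. -/
def IsVerticalIso {x : X}
    (ν : (TangentSpace 𝓘(ℝ, E) x →L[ℝ] W x) ≃ₗ[ℝ] Jet.vertical E F W 1 x) : Prop :=
  ∀ (f : C^∞⟮𝓘(ℝ, E), X; 𝓘(ℝ, ℝ), ℝ⟯) (s q : Cₛ^∞⟮𝓘(ℝ, E); F, W⟯),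
    f x = 0 → (∀ y, q y = f y • s y) →
    (ν ((show TangentSpace 𝓘(ℝ, E) x →L[ℝ] ℝ from mfderiv 𝓘(ℝ, E) 𝓘(ℝ, ℝ) f x).smulRight (s x)) :
      Jet E F W 1 x) = Jet.jet 1 q x

end Stress

section Stresses

variable {d m : ℕ} {F X : Type*}
  [NormedAddCommGroup F] [NormedSpace ℝ F] [FiniteDimensional ℝ F]
  [TopologicalSpace X] [ChartedSpace (Coord (d + 1)) X] [IsManifold 𝓘(ℝ, Coord (d + 1)) ∞ X]
  {W : X → Type*} [TopologicalSpace (TotalSpace F W)] [∀ x, TopologicalSpace (W x)]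
  [∀ x, AddCommGroup (W x)] [∀ x, Module ℝ (W x)] [FiberBundle F W] [VectorBundle ℝ F W]
  [ContMDiffVectorBundle ∞ F W 𝓘(ℝ, Coord (d + 1))]

variable (d F W) in
/-- The fibre at `x` of the bundle `L(J¹(J^r W), ⋀ⁿT*X)` of non-holonomic stresses, with
`n = d + 1 = dim X`. -/
abbrev NonholonomicStress (r : ℕ) (x : X) : Type _ :=
  Jet (Coord (d + 1)) (JetModel (Coord (d + 1)) F r) (Jet (Coord (d + 1)) F W r) 1 x →L[ℝ]
    Form (Coord (d + 1)) (d + 1) x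

variable (d F) in
/-- The typical fibre of the bundle of non-holonomic stresses. -/
abbrev NonholonomicStressModel (r : ℕ) : Type _ :=
  JetModel (Coord (d + 1)) (JetModel (Coord (d + 1)) F r) 1 →L[ℝ]
    (Coord (d + 1) [⋀^Fin (d + 1)]→L[ℝ] ℝ)

variable (d F W) in
/-- The fibre at `x` of the bundle `L(J^r W, ⋀ⁿ⁻¹T*X)` of traction hyper-stresses, with
`n = d + 1 = dim X`. -/
abbrev TractionStress (r : ℕ) (x : X) : Type _ :=
  Jet (Coord (d + 1)) F W r x →L[ℝ] Form (Coord (d + 1)) d x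

variable (d F) in
/-- The typical fibre of the bundle of traction hyper-stresses. -/
abbrev TractionStressModel (r : ℕ) : Type _ :=
  JetModel (Coord (d + 1)) F r →L[ℝ] (Coord (d + 1) [⋀^Fin d]→L[ℝ] ℝ)

open Classical in
/-- The multi-indices `J = j₁ ≤ … ≤ j_l`, `l ≤ r`, with entries in `Fin n`. -/
def MultiIndex (n r : ℕ) : Type := Σ l : Fin (r + 1), {J : Fin l → Fin n // Monotone J}

open Classical in
instance (n r : ℕ) : Fintype (MultiIndex n r) :=
  inferInstanceAs (Fintype (Σ l : Fin (r + 1), {J : Fin l → Fin n // Monotone J}))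

/-- The component `a_J^α` of an array of symmetric multilinear maps. -/
def component {n r : ℕ} (b : Module.Basis (Fin m) ℝ F) (a : JetModel (Coord n) F r)
    (J : MultiIndex n r) (α : Fin m) : ℝ :=
  b.repr (a.1 J.1 (fun t => EuclideanSpace.single (J.2.1 t) 1)) α

/-- The part of order zero of a first jet in coordinates. -/
def orderZero {n : ℕ} {G : Type*} [NormedAddCommGroup G] [NormedSpace ℝ G]
    (c : JetModel (Coord n) G 1) : G := c.1 0 (fun _ => 0)

/-- The partial derivative in the direction `j` of a first jet in coordinates. -/
def orderOne {n : ℕ} {G : Type*} [NormedAddCommGroup G] [NormedSpace ℝ G]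
    (c : JetModel (Coord n) G 1) (j : Fin n) : G := c.1 1 (fun _ => EuclideanSpace.single j 1)

/-- The base vector `∂_j` at `x` induced by a chart. -/
def baseVector (e : OpenPartialHomeomorph X (Coord (d + 1))) (x : X) (j : Fin (d + 1)) :
    TangentSpace 𝓘(ℝ, Coord (d + 1)) x :=
  (show Coord (d + 1) →L[ℝ] TangentSpace 𝓘(ℝ, Coord (d + 1)) x from
    (mfderiv 𝓘(ℝ, Coord (d + 1)) 𝓘(ℝ, Coord (d + 1)) e x).inverse) (EuclideanSpace.single j 1)

/-- The determinant as an alternating form on `ℝⁿ`. -/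
def detForm (n : ℕ) : Coord n [⋀^Fin n]→L[ℝ] ℝ :=
  { (EuclideanSpace.basisFun (Fin n) ℝ).toBasis.det with
    cont := by
      change Continuous fun v : Fin n → Coord n =>
        (Matrix.of fun i j => (v j).ofLp i : Matrix (Fin n) (Fin n) ℝ).det
      refine Continuous.matrix_det (continuous_pi fun i => continuous_pi fun j => ?_)
      exact (EuclideanSpace.proj (𝕜 := ℝ) i).continuous.comp (continuous_apply j) }

/-- The coordinate volume form `dx = dx¹ ∧ … ∧ dxⁿ` at `x` induced by a chart. -/
def coordVolume (e : OpenPartialHomeomorph X (Coord (d + 1))) (x : X) :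
    Form (Coord (d + 1)) (d + 1) x :=
  (detForm (d + 1)).compContinuousLinearMap
    (show TangentSpace 𝓘(ℝ, Coord (d + 1)) x →L[ℝ] Coord (d + 1) from
      mfderiv 𝓘(ℝ, Coord (d + 1)) 𝓘(ℝ, Coord (d + 1)) e x)

variable {r : ℕ}

/-- The components of a non-holonomic stress in adapted coordinates:
`P(A) = (P_α^J A_J^α + P_α^{Jj} A_{Jj}^α) dx`. -/
def HasStressComponents (i : AdaptedChart (Coord (d + 1)) F W) (b : Module.Basis (Fin m) ℝ F) (x : X)
    (P₀ : MultiIndex (d + 1) r → Fin m → ℝ)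
    (P₁ : MultiIndex (d + 1) r → Fin m → Fin (d + 1) → ℝ)
    (P : NonholonomicStress d F W r x) : Prop :=
  ∀ A, P A =
    ((∑ J, ∑ α, P₀ J α * component b (orderZero (Jet.coord (i.prolong r) A)) J α) +
      ∑ J, ∑ α, ∑ j, P₁ J α j * component b (orderOne (Jet.coord (i.prolong r) A) j) J α) •
    coordVolume i.chart x

/-- The components of a traction hyper-stress in adapted coordinates:
`σ(u) = σ_α^{Jj} u_J^α (∂_j ⌟ dx)`. -/
def HasTractionComponents (i : AdaptedChart (Coord (d + 1)) F W) (b : Module.Basis (Fin m) ℝ F)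
    (x : X) (S : MultiIndex (d + 1) r → Fin m → Fin (d + 1) → ℝ)
    (σ : TractionStress d F W r x) : Prop :=
  ∀ u, σ u = ∑ j, (∑ J, ∑ α, S J α j * component b (Jet.coord i u) J α) •
    contract (Coord (d + 1)) x (baseVector i.chart x j) (coordVolume i.chart x)

end Stresses
end HyperStress

end

open HyperStress

noncomputable section

set_option linter.unusedSectionVars false

namespace HyperStress

open Module TensorProduct

/-! ### Forms of top degree and of the degree below, and the interior product. -/

section AlternatingForms

variable {E : Type*} [NormedAddCommGroup E] [NormedSpace ℝ E] {d : ℕ}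

/-! Everything is read off from bases. A nonzero form `θ` of top degree spans the line of `n`-forms,
and `v ↦ v ⌟ θ` is an isomorphism onto the `(n-1)`-forms: evaluated on the basis vectors other than
`e k`, the form `v ⌟ θ` retains only the `k`-th coefficient of `v` (`interiorProd_bijective`). Hence
every element of `T ⊗ U* ⊗ ⋀ⁿT*` is uniquely a sum `∑ e_j ⊗ g_j ⊗ θ`, and the maps `h` and `c` are
bijective because the functionals `g_j` can be recovered from either image. The composite `c ∘ h⁻¹`
sends `H` to `u ↦ ∑ H_j(u) (e_j ⌟ θ)`, where `H(e^j ⊗ u) = H_j(u) θ`, for any basis `e` with dual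
basis `e^j` and any `θ ≠ 0` (`tensorContract_eq_sum`). This freedom of choice carries (b) and (c).

In coordinates a first jet is a pair of a value and a derivative (`firstJet`), and it is vertical
when the value is zero. So `ν` can be defined in the preferred coordinates at the point. In other
adapted coordinates the derivative of the change of frame is multiplied by the value, which is zero,
so vertical jets transform like linear maps (`firstJet_coord_verticalIso`). The product rule gives
the characterization of `ν`. It determines `ν` because the maps `ξ ⊗ w` span `L(T, U)` and bump
functions realize each of them as `df ⊗ s(x)`; the Hausdorff property enters only here.

The map `p_σ` is restriction along `ν` followed by `c ∘ h⁻¹`. Take `e_j = ∂_j` and `θ = dx`. The jet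
`ν(dx^j ⊗ u)` has value zero, and its only possibly nonzero partial derivative is the `j`-th one,
equal to `u`. So the coefficient of `∂_j ⌟ dx` is the first order part of the stress
(`hasTractionComponents_tractionMap`). Components are unique because non-decreasing multi-indices
give coordinates on arrays of symmetric maps (`componentEquiv`). For smoothness, the preferred
trivializations around a point turn `∂_j` into the standard basis and `dx` into the determinant, so
there `p_σ` is a linear map that does not depend on the base point (`trivializationAt_tractionMap`).
-/

theorem map_basis_ne_zero (e : Basis (Fin (d + 1)) ℝ E) {θ : E [⋀^Fin (d + 1)]→L[ℝ] ℝ}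
    (hθ : θ ≠ 0) : θ e ≠ 0 := by
  refine (AlternatingMap.map_basis_ne_zero_iff e θ.toAlternatingMap).2 fun h => hθ ?_
  exact ContinuousAlternatingMap.toAlternatingMap_injective h

/-- Both forms are multiples of the determinant of `e`, with factors their values on `e`. -/
theorem eq_smul_of_ne_zero (e : Basis (Fin (d + 1)) ℝ E) {θ : E [⋀^Fin (d + 1)]→L[ℝ] ℝ}
    (hθ : θ ≠ 0) (η : E [⋀^Fin (d + 1)]→L[ℝ] ℝ) : η = (η e / θ e) • θ := by
  have h0 := map_basis_ne_zero e hθ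
  apply ContinuousAlternatingMap.toAlternatingMap_injective
  have h1 := AlternatingMap.eq_smul_basis_det e η.toAlternatingMap
  have h2 := AlternatingMap.eq_smul_basis_det e θ.toAlternatingMap
  rw [h1]
  change _ = (η e / θ e) • θ.toAlternatingMap
  rw [h2, smul_smul]
  congr 1
  change η e = η e / θ e * θ e
  field_simp

/-- A nonzero form of top degree is a basis of the space of these forms. -/
theorem exists_basis_of_ne_zero (e : Basis (Fin (d + 1)) ℝ E) {θ : E [⋀^Fin (d + 1)]→L[ℝ] ℝ}
    (hθ : θ ≠ 0) : ∃ b : Basis Unit ℝ (E [⋀^Fin (d + 1)]→L[ℝ] ℝ), b () = θ := by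
  refine ⟨Basis.mk (v := fun _ : Unit => θ) (LinearIndependent.of_subsingleton () hθ)
    fun η _ => ?_, by simp⟩
  rw [eq_smul_of_ne_zero e hθ η]
  exact Submodule.smul_mem _ _ (Submodule.subset_span ⟨(), rfl⟩)

/-- Moving the index `k` to the front is a permutation, so this value is `θ e` up to sign. -/
theorem map_cons_succAbove_ne_zero (e : Basis (Fin (d + 1)) ℝ E)
    {θ : E [⋀^Fin (d + 1)]→L[ℝ] ℝ} (hθ : θ ≠ 0) (k : Fin (d + 1)) :
    θ (Fin.cons (e k) (e ∘ k.succAbove)) ≠ 0 := by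
  have hinj : Function.Injective (Fin.cons k k.succAbove : Fin (d + 1) → Fin (d + 1)) := by
    rw [Fin.cons_injective_iff]
    exact ⟨fun ⟨t, ht⟩ => Fin.succAbove_ne k t ht, Fin.succAbove_right_injective⟩
  have h : (Fin.cons (e k) (e ∘ k.succAbove) : Fin (d + 1) → E) =
      e ∘ Equiv.ofBijective _ (Finite.injective_iff_bijective.1 hinj) := by
    funext t
    induction t using Fin.cases <;> simp
  rw [h]
  have := θ.toAlternatingMap.map_perm e (Equiv.ofBijective _ (Finite.injective_iff_bijective.1 hinj))
  change θ.toAlternatingMap _ ≠ 0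
  rw [this]
  have h0 : θ.toAlternatingMap e ≠ 0 := map_basis_ne_zero e hθ
  rcases Int.units_eq_one_or (Equiv.Perm.sign
    (Equiv.ofBijective _ (Finite.injective_iff_bijective.1 hinj))) with h | h <;>
  simpa [h] using h0

/-- For `j ≠ k` the vector `e j` already occurs among the remaining ones. Together with the
preceding lemma this makes the matrix of the interior product diagonal. -/
theorem map_cons_succAbove_of_ne (e : Basis (Fin (d + 1)) ℝ E)
    (θ : E [⋀^Fin (d + 1)]→L[ℝ] ℝ) {j k : Fin (d + 1)} (h : j ≠ k) :
    θ (Fin.cons (e j) (e ∘ k.succAbove)) = 0 := by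
  obtain ⟨t, rfl⟩ := Fin.exists_succAbove_eq h
  exact θ.map_eq_zero_of_eq (i := 0) (j := t.succ) _ (by simp) (Fin.succ_ne_zero t).symm

/-- An injective `d`-tuple of indices misses some `k`, hence is a permutation of `k.succAbove`. -/
theorem alternatingMap_ext_succAbove (e : Basis (Fin (d + 1)) ℝ E) {η ζ : E [⋀^Fin d]→L[ℝ] ℝ}
    (h : ∀ k : Fin (d + 1), η (e ∘ k.succAbove) = ζ (e ∘ k.succAbove)) : η = ζ := by
  apply ContinuousAlternatingMap.toAlternatingMap_injective
  refine Basis.ext_alternating e fun v hv => ?_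
  obtain ⟨k, hk⟩ : ∃ k, k ∉ Set.range v := by
    by_contra! hcon
    have := Fintype.card_le_of_surjective v hcon
    simp at this
  choose s hs using fun t => Fin.exists_succAbove_eq (fun h' : v t = k => hk ⟨t, h'⟩)
  have hs' : Function.Injective s := fun a b hab => hv (by rw [← hs a, ← hs b, hab])
  have hv' : (fun t => e (v t)) =
      (e ∘ k.succAbove) ∘ Equiv.ofBijective s (Finite.injective_iff_bijective.1 hs') := by
    funext t
    simp [hs]
  rw [hv', AlternatingMap.map_perm, AlternatingMap.map_perm]
  exact congrArg _ (h k)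

/-- The interior product with a nonzero form of top degree is an isomorphism. -/
theorem interiorProd_bijective (e : Basis (Fin (d + 1)) ℝ E) {θ : E [⋀^Fin (d + 1)]→L[ℝ] ℝ}
    (hθ : θ ≠ 0) : Function.Bijective fun v : E => interiorProd (d := d) v θ := by
  -- Omitting `e k` from the arguments isolates the `k`-th coefficient, up to a nonzero factor. This
  -- gives both injectivity and the preimage in the proof of surjectivity.
  have key : ∀ (a : Fin (d + 1) → ℝ) k, interiorProd (d := d) (∑ j, a j • e j) θ
      (e ∘ k.succAbove) = a k * θ (Fin.cons (e k) (e ∘ k.succAbove)) := by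
    intro a k
    have : ∀ j, interiorProd (d := d) (e j) θ (e ∘ k.succAbove) =
      θ (Fin.cons (e j) (e ∘ k.succAbove)) := fun j => rfl
    simp only [map_sum, map_smul, LinearMap.sum_apply, LinearMap.smul_apply,
      ContinuousAlternatingMap.sum_apply, ContinuousAlternatingMap.smul_apply, this, smul_eq_mul]
    exact Finset.sum_eq_single_of_mem k (Finset.mem_univ _) fun j _ hj => by
      rw [map_cons_succAbove_of_ne e θ hj, mul_zero]
  constructor
  · refine (injective_iff_map_eq_zero ((interiorProd (E := E) (d := d)).flip θ)).2 fun v hv => ?_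
    apply e.repr.injective
    ext k
    have h := key (fun j => e.repr v j) k
    rw [e.sum_repr] at h
    have hv' : interiorProd (d := d) v θ = 0 := hv
    rw [hv'] at h
    simpa [map_cons_succAbove_ne_zero e hθ k] using h.symm
  · intro η
    refine ⟨∑ j, (η (e ∘ j.succAbove) / θ (Fin.cons (e j) (e ∘ j.succAbove))) • e j, ?_⟩
    refine alternatingMap_ext_succAbove e fun k => ?_
    refine (key _ k).trans ?_
    have := map_cons_succAbove_ne_zero e hθ k
    field_simp

end AlternatingForms

/-! ### The tensor product `T ⊗ U* ⊗ L`, for a line `L`, in terms of bases. -/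

section TensorAlgebra

variable {T U L M : Type*} [NormedAddCommGroup T] [NormedSpace ℝ T]
  [NormedAddCommGroup U] [NormedSpace ℝ U] [AddCommGroup L] [Module ℝ L]
  [AddCommGroup M] [Module ℝ M] {n : ℕ}

/-- Tensoring with a line changes nothing once a generator of the line is chosen. -/
theorem tmul_basis_bijective {N : Type*} [AddCommGroup N] [Module ℝ N] (bL : Basis Unit ℝ L) :
    Function.Bijective fun v : N => v ⊗ₜ[ℝ] bL () := by
  let Ψ := (Finsupp.uniqueLinearEquiv ℝ N ()).symm ≪≫ₗ
    (TensorProduct.equivFinsuppOfBasisRight (M := N) bL).symm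
  convert! Ψ.bijective using 1
  funext v
  have : (Finsupp.uniqueLinearEquiv ℝ N ()).symm v = Finsupp.single () v :=
    (LinearEquiv.symm_apply_eq _).2 (by simp)
  simp [Ψ, this]

theorem lift_bijective (bL : Basis Unit ℝ L) (c : T →ₗ[ℝ] L →ₗ[ℝ] M)
    (hc : Function.Bijective fun v => c v (bL ())) : Function.Bijective (TensorProduct.lift c) := by
  refine (Function.Bijective.of_comp_iff _ (tmul_basis_bijective (N := T) bL)).1 ?_
  convert! hc using 1

/-- Every element of `T ⊗ U* ⊗ L` has unique components in `U*`. -/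
theorem sum_tmul_bijective (N : Type*) [AddCommGroup N] [Module ℝ N] (e : Basis (Fin n) ℝ T)
    (bL : Basis Unit ℝ L) :
    Function.Bijective fun g : Fin n → N => ∑ j, e j ⊗ₜ[ℝ] (g j ⊗ₜ[ℝ] bL ()) := by
  let Ψ := LinearEquiv.piCongrRight (fun _ : Fin n => LinearEquiv.ofBijective
    ((TensorProduct.mk ℝ N L).flip (bL ())) (tmul_basis_bijective bL)) ≪≫ₗ
    (Finsupp.linearEquivFunOnFinite ℝ (N ⊗[ℝ] L) (Fin n)).symm ≪≫ₗ
    (TensorProduct.equivFinsuppOfBasisLeft e).symm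
  convert! Ψ.bijective using 1
  funext g
  simp only [Ψ, LinearEquiv.trans_apply, TensorProduct.equivFinsuppOfBasisLeft_symm_apply]
  rw [Finsupp.sum_fintype _ _ (by simp)]
  rfl

variable [FiniteDimensional ℝ T] [FiniteDimensional ℝ U]

/-- The linear map `ξ ⊗ u` of rank one, for an element `ξ` of the dual basis. -/
def coordSMul (e : Basis (Fin n) ℝ T) (j : Fin n) : U →ₗ[ℝ] (T →L[ℝ] U) where
  toFun u := (LinearMap.toContinuousLinearMap (e.coord j)).smulRight u
  map_add' u v := by ext; simp
  map_smul' c u := by ext; simp [smul_comm c]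

@[simp]
theorem coordSMul_apply (e : Basis (Fin n) ℝ T) (j : Fin n) (u : U) (v : T) :
    coordSMul e j u v = e.repr v j • u := rfl

theorem sum_coordSMul (e : Basis (Fin n) ℝ T) (A : T →L[ℝ] U) :
    ∑ j, coordSMul e j (A (e j)) = A := by
  ext v
  conv_rhs => rw [← e.sum_repr v]
  simp [-Basis.sum_repr]

/-- After the parametrization by tuples `g` of functionals, `g` corresponds to the map `A ↦ (∑ g_j(A
e_j)) θ`, and rank-one maps recover each `g_j`. -/
theorem tensorToHom_bijective (e : Basis (Fin n) ℝ T) (bL : Basis Unit ℝ L) :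
    Function.Bijective (tensorToHom T U L) := by
  refine (Function.Bijective.of_comp_iff _ (sum_tmul_bijective (U →L[ℝ] ℝ) e bL)).1 ?_
  have key : ∀ (g : Fin n → U →L[ℝ] ℝ) A, tensorToHom T U L (∑ j, e j ⊗ₜ[ℝ] (g j ⊗ₜ[ℝ] bL ())) A =
      (∑ j, g j (A (e j))) • bL () := by
    intro g A
    simp [map_sum, LinearMap.sum_apply, Finset.sum_smul]
  constructor
  -- Testing on the rank-one map `e^i ⊗ u` isolates `g i u`.
  · intro g g' h
    funext i
    ext u
    have := LinearMap.congr_fun h (coordSMul e i u)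
    simp only [Function.comp_apply, key] at this
    have := smul_left_injective ℝ (bL.ne_zero ()) this
    simpa [Finsupp.single_apply, ite_smul, apply_ite] using this
  -- The functionals are the values of `H` on `e^j ⊗ u`; they suffice because `A = ∑ e^j ⊗ A e_j`.
  · intro H
    refine ⟨fun j => LinearMap.toContinuousLinearMap (bL.coord () ∘ₗ H ∘ₗ coordSMul e j), ?_⟩
    ext A
    rw [Function.comp_apply, key]
    conv_rhs => rw [← sum_coordSMul e A, map_sum, ← bL.sum_repr (∑ j, _)]
    simp [Finset.sum_smul]

theorem tensorContract_bijective (e : Basis (Fin n) ℝ T) (bL : Basis Unit ℝ L)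
    (c : T →ₗ[ℝ] L →ₗ[ℝ] M) (hc : Function.Bijective fun v => c v (bL ())) :
    Function.Bijective (tensorContract U M c) := by
  refine (Function.Bijective.of_comp_iff _ (sum_tmul_bijective (U →L[ℝ] ℝ) e bL)).1 ?_
  -- By `hc` the vectors `c (e j) θ` form a basis of `M`, so the `g j` are exactly the coordinates
  -- of the image.
  let b : Basis (Fin n) ℝ M := e.map (LinearEquiv.ofBijective (c.flip (bL ())) hc)
  have key : ∀ (g : Fin n → U →L[ℝ] ℝ) u,
      tensorContract U M c (∑ j, e j ⊗ₜ[ℝ] (g j ⊗ₜ[ℝ] bL ())) u = ∑ j, g j u • b j := by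
    intro g u
    simp only [map_sum, LinearMap.sum_apply, tensorContract_tmul]
    rfl
  constructor
  · intro g g' h
    funext i
    ext u
    have := LinearMap.congr_fun h u
    simp only [Function.comp_apply, key] at this
    have := congrArg (fun z => b.repr z i) this
    simpa [Finsupp.single_apply] using this
  · intro H
    refine ⟨fun j => LinearMap.toContinuousLinearMap (b.coord j ∘ₗ H), ?_⟩
    ext u
    rw [Function.comp_apply, key]
    exact b.sum_repr (H u)

/-- The composite of `tensorContract` with the inverse of `tensorToHom`, in terms of bases. -/
theorem tensorContract_eq_sum (e : Basis (Fin n) ℝ T) (bL : Basis Unit ℝ L)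
    (c : T →ₗ[ℝ] L →ₗ[ℝ] M) (τ : T ⊗[ℝ] ((U →L[ℝ] ℝ) ⊗[ℝ] L)) (u : U) :
    tensorContract U M c τ u =
      ∑ j, bL.repr (tensorToHom T U L τ (coordSMul e j u)) () • c (e j) (bL ()) := by
  obtain ⟨g, rfl⟩ := (sum_tmul_bijective (U →L[ℝ] ℝ) e bL).2 τ
  simp [map_sum, LinearMap.sum_apply, Finsupp.single_apply, ite_smul, apply_ite]

end TensorAlgebra

end HyperStress

namespace HyperStress

/-! ### First jets in coordinates as pairs of a value and a derivative. -/

section FirstJet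

variable {E G : Type*} [NormedAddCommGroup E] [NormedSpace ℝ E]
  [NormedAddCommGroup G] [NormedSpace ℝ G]

/-- The value and the derivative recorded by a first jet. -/
def firstJetMap : JetModel E G 1 →ₗ[ℝ] G × (E →L[ℝ] G) where
  toFun a := (a.1 0 (fun _ => 0), continuousMultilinearCurryFin1 ℝ E G (a.1 1))
  map_add' _ _ := rfl
  map_smul' _ _ := rfl

theorem firstJetMap_jetOf {f : E → G} {y : E} (hf : ContDiffAt ℝ ∞ f y) :
    firstJetMap (jetOf 1 f y hf) = (f y, fderiv ℝ f y) := by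
  refine Prod.ext (iteratedFDeriv_zero_apply _) ?_
  ext v
  exact (iteratedFDeriv_one_apply _).trans rfl

theorem firstJetMap_bijective : Function.Bijective (firstJetMap (E := E) (G := G)) := by
  constructor
  · intro a b h
    apply Subtype.ext
    funext l
    induction l using Fin.cases with
    | zero =>
      ext v
      have := congrArg Prod.fst h
      rwa [show v = fun _ => 0 from funext fun t => Fin.elim0 t]
    | succ l =>
      obtain rfl : l = 0 := Subsingleton.elim _ _
      exact (continuousMultilinearCurryFin1 ℝ E G).injective (congrArg Prod.snd h)
  · rintro ⟨g, B⟩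
    -- An affine map has the prescribed value and derivative. Taking the jet of a function also
    -- supplies the symmetry condition.
    refine ⟨jetOf 1 (fun y => g + B y) 0 (contDiffAt_const.add B.contDiff.contDiffAt), ?_⟩
    rw [firstJetMap_jetOf]
    simp

/-- A first jet consists of a value and a derivative. -/
def firstJet : JetModel E G 1 ≃ₗ[ℝ] G × (E →L[ℝ] G) :=
  LinearEquiv.ofBijective firstJetMap firstJetMap_bijective

theorem firstJet_jetOf {f : E → G} {y : E} (hf : ContDiffAt ℝ ∞ f y) :
    firstJet (jetOf 1 f y hf) = (f y, fderiv ℝ f y) :=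
  firstJetMap_jetOf hf

theorem firstJet_fst (a : JetModel E G 1) : (firstJet a).1 = a.1 0 (fun _ => 0) := rfl

theorem orderZero_eq {n : ℕ} (c : JetModel (Coord n) G 1) : orderZero c = (firstJet c).1 := rfl

theorem orderOne_eq {n : ℕ} (c : JetModel (Coord n) G 1) (j : Fin n) :
    orderOne c j = (firstJet c).2 (EuclideanSpace.single j 1) := by
  refine congrArg (c.1 1) ?_
  exact funext fun t : Fin 1 => by rw [Subsingleton.elim t 0]; rfl

/-- The derivative of a product whose second factor vanishes. -/
theorem fderiv_clm_apply_of_eq_zero {F : Type*} [NormedAddCommGroup F] [NormedSpace ℝ F]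
    {g : E → F →L[ℝ] G} {f : E → F} {y : E}
    (hg : DifferentiableAt ℝ g y) (hf : DifferentiableAt ℝ f y) (h0 : f y = 0) :
    fderiv ℝ (fun z => g z (f z)) y = g y ∘L fderiv ℝ f y := by
  rw [fderiv_clm_apply hg hf, h0]
  ext v
  simp

end FirstJet

/-! ### Derivatives of charts, and sections and functions with prescribed data at a point. -/

section Charts

variable {E F X : Type*} [NormedAddCommGroup E] [NormedSpace ℝ E]
  [NormedAddCommGroup F] [NormedSpace ℝ F]
  [TopologicalSpace X] [ChartedSpace E X]
  {W : X → Type*} [TopologicalSpace (TotalSpace F W)] [∀ x, TopologicalSpace (W x)]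
  [∀ x, AddCommGroup (W x)] [∀ x, Module ℝ (W x)] [FiberBundle F W] [VectorBundle ℝ F W]
  [IsManifold 𝓘(ℝ, E) ∞ X] [ContMDiffVectorBundle ∞ F W 𝓘(ℝ, E)]

/-- The tangent space at `x` is the model space, identified through the preferred chart at `x`. -/
theorem mfderiv_eq_fderiv_comp_symm {E' : Type*} [NormedAddCommGroup E'] [NormedSpace ℝ E']
    {f : X → E'} {x : X} (hf : MDifferentiableAt 𝓘(ℝ, E) 𝓘(ℝ, E') f x) :
    mfderiv 𝓘(ℝ, E) 𝓘(ℝ, E') f x = fderiv ℝ (f ∘ (chartAt E x).symm) (chartAt E x x) := by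
  refine hf.mfderiv.trans ?_
  simp only [mfld_simps, fderivWithin_univ]
  rfl

variable [FiniteDimensional ℝ E] [FiniteDimensional ℝ F]

namespace AdaptedChart

/-- Chain rule for two mutually inverse changes of coordinates. It makes the derivative of a chart
invertible. -/
theorem fderiv_baseChange_comp (i j : AdaptedChart E F W) {x : X} (hi : x ∈ i.dom)
    (hj : x ∈ j.dom) : fderiv ℝ (baseChange i j) (j.chart x) ∘L fderiv ℝ (baseChange j i) (i.chart x)
      = ContinuousLinearMap.id ℝ E := by
  have h1 := (contDiffAt_baseChange j i hj hi).differentiableAt (by simp)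
  have h2 := (contDiffAt_baseChange i j hi hj).differentiableAt (by simp)
  rw [← baseChange_apply j i hi] at h2
  have h3 := fderiv_comp (i.chart x) h2 h1
  rw [baseChange_apply j i hi] at h3
  rw [← h3, ← fderiv_id (𝕜 := ℝ) (x := i.chart x)]
  apply Filter.EventuallyEq.fderiv_eq
  filter_upwards [eventually_dom j i hj hi] with z hz
  simp only [Function.comp_apply, baseChange]
  rw [j.chart.left_inv hz.2.1.1, i.chart.right_inv hz.1]
  rfl

theorem mfderiv_chart (i : AdaptedChart E F W) {x : X} (hx : x ∈ i.dom) :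
    mfderiv 𝓘(ℝ, E) 𝓘(ℝ, E) i.chart x = fderiv ℝ (baseChange i (at' F W x)) (chartAt E x x) := by
  exact mfderiv_eq_fderiv_comp_symm
    ((contMDiffAt_of_mem_maximalAtlas i.chart_mem hx.1).mdifferentiableAt (by simp))

/-- The derivative of a chart at a point of its domain. -/
def chartDeriv (i : AdaptedChart E F W) {x : X} (hx : x ∈ i.dom) :
    TangentSpace 𝓘(ℝ, E) x ≃L[ℝ] E :=
  (ContinuousLinearEquiv.equivOfInverse
    (fderiv ℝ (baseChange i (at' F W x)) ((at' F W x : AdaptedChart E F W).chart x))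
    (fderiv ℝ (baseChange (at' F W x) i) (i.chart x))
    (ContinuousLinearMap.ext_iff.1 (fderiv_baseChange_comp _ _ (mem_dom_at' x) hx))
    (ContinuousLinearMap.ext_iff.1 (fderiv_baseChange_comp _ _ hx (mem_dom_at' x))) : E ≃L[ℝ] E)

theorem coe_chartDeriv (i : AdaptedChart E F W) {x : X} (hx : x ∈ i.dom) :
    (i.chartDeriv hx : TangentSpace 𝓘(ℝ, E) x →L[ℝ] E) =
      mfderiv 𝓘(ℝ, E) 𝓘(ℝ, E) i.chart x :=
  (i.mfderiv_chart hx).symm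

theorem coe_chartDeriv_symm (i : AdaptedChart E F W) {x : X} (hx : x ∈ i.dom) :
    ((i.chartDeriv hx).symm : E →L[ℝ] TangentSpace 𝓘(ℝ, E) x) =
      fderiv ℝ (baseChange (at' F W x) i) (i.chart x) :=
  rfl

end AdaptedChart

variable [T2Space X]

/-- A local smooth extension of `w` is cut off by a bump function supported where the extension is
smooth. -/
theorem exists_section_eq (x : X) (w : W x) : ∃ s : Cₛ^∞⟮𝓘(ℝ, E); F, W⟯, s x = w := by
  obtain ⟨v, hv, hs⟩ := FiberBundle.exists_contMDiffOn_extend (k := ∞) 𝓘(ℝ, E) F w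
  obtain ⟨b, -, hb⟩ := (SmoothBumpFunction.nhds_basis_tsupport (I := 𝓘(ℝ, E)) x).mem_iff.1
    (interior_mem_nhds.2 hv)
  refine ⟨⟨fun y => b y • FiberBundle.extend F w y, ?_⟩, ?_⟩
  · exact ContMDiffOn.smul_section_of_tsupport (b.contMDiff.contMDiffOn) isOpen_interior hb
      (hs.mono interior_subset)
  · change b x • FiberBundle.extend F w x = w
    rw [b.eq_one]
    simp

/-- In the preferred chart an affine function has derivative `ξ`; a bump function makes it global.
-/
theorem exists_function_mfderiv_eq (x : X) (ξ : E →L[ℝ] ℝ) :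
    ∃ f : C^∞⟮𝓘(ℝ, E), X; 𝓘(ℝ, ℝ), ℝ⟯, f x = 0 ∧ mfderiv 𝓘(ℝ, E) 𝓘(ℝ, ℝ) f x = ξ := by
  let b : SmoothBumpFunction 𝓘(ℝ, E) x := Classical.arbitrary _
  let g : X → ℝ := fun y => ξ (chartAt E x y - chartAt E x x)
  have hg : ContMDiffOn 𝓘(ℝ, E) 𝓘(ℝ, ℝ) ∞ g (chartAt E x).source := by
    have h1 : ContMDiff 𝓘(ℝ, E) 𝓘(ℝ, ℝ) ∞ fun y => ξ (y - chartAt E x x) :=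
      (ξ.contDiff.comp (contDiff_id.sub contDiff_const)).contMDiff
    exact h1.comp_contMDiffOn (contMDiffOn_chart (I := 𝓘(ℝ, E)))
  let f : C^∞⟮𝓘(ℝ, E), X; 𝓘(ℝ, ℝ), ℝ⟯ := ⟨fun y => b y • g y, b.contMDiff_smul hg⟩
  refine ⟨f, ?_, ?_⟩
  · change b x • g x = 0
    simp [g]
  · have h : MDifferentiableAt 𝓘(ℝ, E) 𝓘(ℝ, ℝ) f x := f.contMDiff.mdifferentiableAt (by simp)
    refine (mfderiv_eq_fderiv_comp_symm h).trans ?_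
    -- The bump function equals `1` near `x`, so it does not affect the derivative.
    have hev : f ∘ (chartAt E x).symm =ᶠ[𝓝 (chartAt E x x)] fun z => ξ (z - chartAt E x x) := by
      have h1 : ∀ᶠ z in 𝓝 (chartAt E x x), b ((chartAt E x).symm z) = 1 := by
        have := (chartAt E x).continuousAt_symm (mem_chart_target E x)
        rw [ContinuousAt, (chartAt E x).left_inv (mem_chart_source E x)] at this
        exact this.eventually b.eventuallyEq_one
      filter_upwards [h1, (chartAt E x).open_target.mem_nhds (mem_chart_target E x)] with z hz hz'
      change b _ • ξ _ = _
      rw [hz, (chartAt E x).right_inv hz', one_smul]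
    rw [hev.fderiv_eq]
    simp only [map_sub]
    rw [fderiv_sub_const]
    exact ξ.fderiv

end Charts

end HyperStress

namespace HyperStress

/-! ### The natural isomorphism `ν` onto vertical first jets. -/

section Vertical

variable {E F X : Type*} [NormedAddCommGroup E] [NormedSpace ℝ E]
  [NormedAddCommGroup F] [NormedSpace ℝ F]
  [TopologicalSpace X] [ChartedSpace E X]
  {W : X → Type*} [TopologicalSpace (TotalSpace F W)] [∀ x, TopologicalSpace (W x)]
  [∀ x, AddCommGroup (W x)] [∀ x, Module ℝ (W x)] [FiberBundle F W] [VectorBundle ℝ F W]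
  [IsManifold 𝓘(ℝ, E) ∞ X] [ContMDiffVectorBundle ∞ F W 𝓘(ℝ, E)]
  [FiniteDimensional ℝ E] [FiniteDimensional ℝ F]

variable (E F W) in
/-- The identification of a fibre of the jet bundle with the typical fibre by means of the preferred
adapted coordinates. -/
def jetFiberEquiv (r : ℕ) (x : X) : JetModel E F r ≃ₗ[ℝ] Jet E F W r x :=
  LinearEquiv.refl ℝ (JetModel E F r)

theorem coord_jetFiberEquiv {r : ℕ} (i : AdaptedChart E F W) {x : X} (a : JetModel E F r) :
    Jet.coord i (jetFiberEquiv E F W r x a) =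
      AdaptedChart.jetChange r (AdaptedChart.at' F W x) i x a := rfl

/-- The linear isomorphism of the fibre of the jet bundle and the typical fibre that is given by
adapted coordinates. -/
def coordEquiv (r : ℕ) (i : AdaptedChart E F W) {x : X} (hx : x ∈ i.dom) :
    Jet E F W r x ≃L[ℝ] JetModel E F r :=
  (Jet.triv r i).continuousLinearEquivAt ℝ x hx

theorem coordEquiv_apply {r : ℕ} (i : AdaptedChart E F W) {x : X} (hx : x ∈ i.dom)
    (A : Jet E F W r x) : coordEquiv r i hx A = Jet.coord i A := rfl

variable (F W) in
/-- The identification of a fibre with the typical fibre by the preferred trivialization. -/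
def fiberEquiv (x : X) : W x ≃L[ℝ] F :=
  (trivializationAt F W x).continuousLinearEquivAt ℝ x (mem_baseSet_trivializationAt F W x)

theorem symm_fiberEquiv (x : X) : ⇑(fiberEquiv F W x).symm =
    (trivializationAt F W x).symmL ℝ x :=
  Trivialization.symm_continuousLinearEquivAt_eq _ _

theorem mem_vertical_iff {x : X} (a : JetModel E F 1) :
    jetFiberEquiv E F W 1 x a ∈ Jet.vertical E F W 1 x ↔ (firstJet a).1 = 0 := by
  rw [firstJet_fst]
  change (trivializationAt F W x).symmL ℝ x (a.1 0 fun _ => 0) = 0 ↔ _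
  rw [← symm_fiberEquiv]
  exact (fiberEquiv F W x).symm.map_eq_zero_iff (x := a.1 0 fun _ => 0)

variable [∀ x, IsTopologicalAddGroup (W x)] [∀ x, ContinuousSMul ℝ (W x)]

variable (E F W) in
/-- The jet at `x` whose value is zero and whose derivative is a given linear map. -/
def verticalMap (x : X) : (E →L[ℝ] W x) →ₗ[ℝ] Jet E F W 1 x :=
  (jetFiberEquiv E F W 1 x).toLinearMap ∘ₗ (firstJet (E := E) (G := F)).symm.toLinearMap ∘ₗ
    LinearMap.inr ℝ F (E →L[ℝ] F) ∘ₗ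
      { toFun A := (fiberEquiv F W x : W x →L[ℝ] F) ∘L A
        map_add' A B := by ext; simp
        map_smul' c A := by ext; simp }

theorem verticalMap_apply {x : X} (A : E →L[ℝ] W x) : verticalMap E F W x A =
    jetFiberEquiv E F W 1 x (firstJet.symm (0, (fiberEquiv F W x : W x →L[ℝ] F) ∘L A)) := rfl

theorem verticalMap_mem_vertical {x : X} (A : E →L[ℝ] W x) :
    verticalMap E F W x A ∈ Jet.vertical E F W 1 x := by
  rw [verticalMap_apply, mem_vertical_iff, LinearEquiv.apply_symm_apply]

variable (E F W) in
-- The inverse takes the derivative part of a vertical jet and transports it back to the fibre.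
theorem verticalMap_codRestrict_bijective (x : X) : Function.Bijective
    ((verticalMap E F W x).codRestrict (Jet.vertical E F W 1 x) verticalMap_mem_vertical) := by
  constructor
  · intro A B h
    have h1 : verticalMap E F W x A = verticalMap E F W x B := congrArg Subtype.val h
    rw [verticalMap_apply, verticalMap_apply] at h1
    have h2 := firstJet.symm.injective ((jetFiberEquiv E F W 1 x).injective h1)
    ext v
    exact (fiberEquiv F W x).injective (ContinuousLinearMap.ext_iff.1 (Prod.ext_iff.1 h2).2 v)
  · rintro ⟨a, ha⟩
    obtain ⟨a, rfl⟩ := (jetFiberEquiv E F W 1 x).surjective a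
    refine ⟨((fiberEquiv F W x).symm : F →L[ℝ] W x) ∘L (firstJet a).2, ?_⟩
    apply Subtype.ext
    rw [LinearMap.codRestrict_apply, verticalMap_apply]
    congr 1
    rw [LinearEquiv.symm_apply_eq]
    refine Prod.ext ((mem_vertical_iff a).1 ha).symm ?_
    ext v
    simp

variable (E F W) in
/-- The natural isomorphism of `L(T_xX, W_x)` and the vertical subspace of `J¹W_x`. -/
def verticalIso (x : X) :
    (TangentSpace 𝓘(ℝ, E) x →L[ℝ] W x) ≃ₗ[ℝ] Jet.vertical E F W 1 x :=
  LinearEquiv.ofBijective (M := E →L[ℝ] W x) _ (verticalMap_codRestrict_bijective E F W x)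

/-- The coordinates of the vertical jet that corresponds to a linear map. -/
theorem firstJet_coord_verticalIso (i : AdaptedChart E F W) {x : X} (hx : x ∈ i.dom)
    (A : TangentSpace 𝓘(ℝ, E) x →L[ℝ] W x) :
    firstJet (Jet.coord i (verticalIso E F W x A : Jet E F W 1 x)) =
      (0, (i.triv.continuousLinearMapAt ℝ x) ∘L A ∘L
        ((i.chartDeriv hx).symm : E →L[ℝ] TangentSpace 𝓘(ℝ, E) x)) := by
  set j : AdaptedChart E F W := AdaptedChart.at' F W x with hj
  have h0 : x ∈ j.dom := AdaptedChart.mem_dom_at' x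
  let B : E →L[ℝ] F := ((fiberEquiv F W x : W x →L[ℝ] F) ∘L A : TangentSpace 𝓘(ℝ, E) x →L[ℝ] F)
  have hB : ContDiff ℝ ∞ fun y => B (y - j.chart x) := by fun_prop
  -- Representing the jet by a function makes `jetChange_jetOf` applicable, which replaces the
  -- Taylor polynomials in the transformation rule.
  have h1 : firstJet.symm ((0 : F), B) = jetOf 1 (fun y => B (y - j.chart x)) (j.chart x)
      hB.contDiffAt := by
    apply firstJet.injective
    rw [firstJet_jetOf, LinearEquiv.apply_symm_apply]
    simp only [sub_self, map_zero, map_sub, fderiv_sub_const, B.fderiv]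
  change firstJet (Jet.coord i (jetFiberEquiv E F W 1 x (firstJet.symm (0, B)))) = _
  rw [coord_jetFiberEquiv, h1, AdaptedChart.jetChange_jetOf _ _ h0 hx, firstJet_jetOf]
  have hb : B (AdaptedChart.baseChange j i (i.chart x) - j.chart x) = 0 := by
    rw [AdaptedChart.baseChange_apply j i hx, sub_self, map_zero]
  have hd := (AdaptedChart.contDiffAt_baseChange j i h0 hx).differentiableAt
    (by simp : (∞ : WithTop ℕ∞) ≠ 0)
  have hd' : HasFDerivAt (fun z => B (AdaptedChart.baseChange j i z - j.chart x))
      (B ∘L fderiv ℝ (AdaptedChart.baseChange j i) (i.chart x)) (i.chart x) :=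
    B.hasFDerivAt.comp _ (hd.hasFDerivAt.sub_const _)
  -- The representative vanishes at the point, so the term with the derivative of the change of
  -- frame drops out.
  rw [fderiv_clm_apply_of_eq_zero
    ((AdaptedChart.contDiffAt_frameChange j i h0 hx).differentiableAt (by simp))
    hd'.differentiableAt hb, hd'.fderiv, hb, map_zero]
  refine Prod.ext rfl ?_
  apply ContinuousLinearMap.ext
  intro v
  change AdaptedChart.frameChange j i (i.chart x) (fiberEquiv F W x
    (A ((i.chartDeriv hx).symm v))) = i.triv.continuousLinearMapAt ℝ x
      (A ((i.chartDeriv hx).symm v))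
  generalize A ((i.chartDeriv hx).symm v) = w
  rw [AdaptedChart.frameChange, i.chart.left_inv hx.1]
  simp only [ContinuousLinearEquiv.coe_coe]
  rw [Trivialization.coordChangeL_apply _ _ ⟨h0.2, hx.2⟩,
    Trivialization.continuousLinearMapAt_apply_of_mem _ _ hx.2]
  exact congrArg (fun w' => (i.triv ⟨x, w'⟩).2) (j.triv.symm_apply_apply_mk h0.2 w)

/-- Product rule in the preferred coordinates: since `f x = 0`, the derivative of `f s` is `df ⊗
s(x)` and its value is zero. -/
theorem isVerticalIso_verticalIso (x : X) : IsVerticalIso (verticalIso E F W x) := by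
  intro f s q hf hq
  set j : AdaptedChart E F W := AdaptedChart.at' F W x with hj
  have h0 : x ∈ j.dom := AdaptedChart.mem_dom_at' x
  apply (coordEquiv 1 j h0).injective
  rw [coordEquiv_apply, coordEquiv_apply]
  apply firstJet.injective
  rw [firstJet_coord_verticalIso j h0, Jet.coord_jet j h0, firstJet_jetOf]
  have hs := (j.contDiffAt_repr h0 s).differentiableAt (by simp : (∞ : WithTop ℕ∞) ≠ 0)
  have hfx : MDifferentiableAt 𝓘(ℝ, E) 𝓘(ℝ, ℝ) f x := f.contMDiff.mdifferentiableAt (by simp)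
  have hfd : DifferentiableAt ℝ (f ∘ j.chart.symm) (j.chart x) := by
    rw [← mdifferentiableAt_iff_differentiableAt]
    refine MDifferentiableAt.comp _ ?_ ((j.contDiffAt_symm h0.1).mdifferentiableAt (by simp))
    rwa [j.chart.left_inv h0.1]
  have hev : j.repr q =ᶠ[𝓝 (j.chart x)] fun y => (f ∘ j.chart.symm) y • j.repr s y := by
    filter_upwards [AdaptedChart.eventually_dom j j h0 h0] with z hz
    rw [AdaptedChart.repr, hq, AdaptedChart.repr]
    exact (j.triv.linear ℝ hz.2.1.2).map_smul _ _
  have hv : (f ∘ j.chart.symm) (j.chart x) = 0 := by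
    rw [Function.comp_apply, j.chart.left_inv h0.1, hf]
  have hsx : j.repr s (j.chart x) = (j.triv ⟨x, s x⟩).2 := by
    rw [AdaptedChart.repr, j.chart.left_inv h0.1]
  rw [hev.fderiv_eq, hev.eq_of_nhds, fderiv_fun_smul hfd hs, hv, zero_smul, zero_smul, zero_add, hsx]
  refine Prod.ext rfl ?_
  apply ContinuousLinearMap.ext
  intro v
  -- The preferred chart at `x` is the one that identifies the tangent space with the model space,
  -- so its derivative is the identity.
  have hD : (j.chartDeriv h0).symm v = v := by
    have h1 : AdaptedChart.baseChange j j =ᶠ[𝓝 (j.chart x)] id := by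
      filter_upwards [j.chart.open_target.mem_nhds (j.chart.map_source h0.1)] with z hz
      exact j.chart.right_inv hz
    change fderiv ℝ (AdaptedChart.baseChange j j) (j.chart x) v = v
    rw [h1.fderiv_eq, fderiv_id]
    rfl
  have hm : mfderiv 𝓘(ℝ, E) 𝓘(ℝ, ℝ) f x = fderiv ℝ (f ∘ j.chart.symm) (j.chart x) :=
    mfderiv_eq_fderiv_comp_symm hfx
  change j.triv.continuousLinearMapAt ℝ x
    ((show E →L[ℝ] ℝ from mfderiv 𝓘(ℝ, E) 𝓘(ℝ, ℝ) f x) ((j.chartDeriv h0).symm v) • s x) =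
    fderiv ℝ (f ∘ j.chart.symm) (j.chart x) v • (j.triv ⟨x, s x⟩).2
  rw [hD, hm, map_smul, Trivialization.continuousLinearMapAt_apply_of_mem _ _ h0.2]

/-- Every rank-one map has the form `df ⊗ s(x)` with `f x = 0`, and rank-one maps span. -/
theorem IsVerticalIso.unique [T2Space X] {x : X}
    {ν ν' : (TangentSpace 𝓘(ℝ, E) x →L[ℝ] W x) ≃ₗ[ℝ] Jet.vertical E F W 1 x}
    (h : IsVerticalIso ν) (h' : IsVerticalIso ν') : ν = ν' := by
  have key : ∀ (ξ : E →L[ℝ] ℝ) (w : W x), ν (ξ.smulRight w : E →L[ℝ] W x) =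
      ν' (ξ.smulRight w : E →L[ℝ] W x) := by
    intro ξ w
    obtain ⟨f, hf, hfd⟩ := exists_function_mfderiv_eq x ξ
    obtain ⟨s, rfl⟩ := exists_section_eq (E := E) (F := F) x w
    let q : Cₛ^∞⟮𝓘(ℝ, E); F, W⟯ := ⟨fun y => f y • s y, f.contMDiff.smul_section s.contMDiff⟩
    have h1 := h f s q hf fun _ => rfl
    have h2 := h' f s q hf fun _ => rfl
    rw [hfd] at h1 h2
    exact Subtype.ext (h1.trans h2.symm)
  let e := Module.finBasis ℝ E
  have hA : ∀ A : E →L[ℝ] W x,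
      A = ∑ k, (LinearMap.toContinuousLinearMap (e.coord k)).smulRight (A (e k)) := by
    intro A
    ext v
    conv_lhs => rw [← e.sum_repr v, map_sum]
    simp
  apply LinearEquiv.ext
  intro A
  refine (congrArg ν (hA A)).trans (Eq.trans ?_ (congrArg ν' (hA A)).symm)
  refine (map_sum ν (fun k => ((LinearMap.toContinuousLinearMap (e.coord k)).smulRight
    (show W x from A (e k)) : E →L[ℝ] W x)) Finset.univ).trans (Eq.trans ?_ (map_sum ν' _ _).symm)
  exact Finset.sum_congr rfl fun k _ => key _ _

end Vertical

end HyperStress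

namespace HyperStress

/-! ### Components of jets indexed by non-decreasing multi-indices. -/

section Components

variable {m n r : ℕ} {F : Type*} [NormedAddCommGroup F] [NormedSpace ℝ F]

/-- The components of an array of symmetric multilinear maps, as a linear map. -/
def componentMap (b : Module.Basis (Fin m) ℝ F) :
    JetModel (Coord n) F r →ₗ[ℝ] (MultiIndex n r → Fin m → ℝ) where
  toFun a J α := component b a J α
  map_add' a a' := by
    funext J α
    change b.repr (a.1 J.1 _ + a'.1 J.1 _) α = _
    simp [component]
  map_smul' c a := by
    funext J α
    change b.repr (c • a.1 J.1 _) α = _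
    simp [component]

/-- A multilinear map is determined by its values on tuples of basis vectors, and symmetry allows
each tuple to be sorted. -/
theorem componentMap_injective (b : Module.Basis (Fin m) ℝ F) :
    Function.Injective (componentMap (n := n) (r := r) b) := by
  intro a a' h
  apply Subtype.ext
  funext l
  apply ContinuousMultilinearMap.toMultilinearMap_injective
  refine Module.Basis.ext_multilinear
    (fun _ => (EuclideanSpace.basisFun (Fin n) ℝ).toBasis) fun J => ?_
  have hJ : ∀ a : JetModel (Coord n) F r, a.1 l (fun t => EuclideanSpace.single (J t) 1) =
      a.1 l (fun t => EuclideanSpace.single ((J ∘ Tuple.sort J) t) 1) := fun a =>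
    (a.2 l (Tuple.sort J) (fun t => EuclideanSpace.single (J t) 1)).symm
  have h1 : a.1 l (fun t => EuclideanSpace.single (J t) 1) =
      a'.1 l (fun t => EuclideanSpace.single (J t) 1) := by
    rw [hJ a, hJ a']
    apply b.repr.injective
    ext α
    exact congrFun (congrFun h ⟨l, J ∘ Tuple.sort J, Tuple.monotone_sort J⟩) α
  simpa using h1

/-- The symmetric multilinear map with prescribed values on tuples of base vectors. -/
def multilinearOfTuples {l : ℕ} (z : (Fin l → Fin n) → F) : Coord n [×l]→L[ℝ] F :=
  ∑ K : Fin l → Fin n, ((ContinuousMultilinearMap.mkPiAlgebra ℝ (Fin l) ℝ).compContinuousLinearMap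
    fun t => EuclideanSpace.proj (K t)).smulRight (z K)

theorem multilinearOfTuples_apply {l : ℕ} (z : (Fin l → Fin n) → F) (v : Fin l → Coord n) :
    multilinearOfTuples z v = ∑ K : Fin l → Fin n, (∏ t, v t (K t)) • z K := by
  simp [multilinearOfTuples]

theorem multilinearOfTuples_single {l : ℕ} (z : (Fin l → Fin n) → F) (J : Fin l → Fin n) :
    multilinearOfTuples z (fun t => EuclideanSpace.single (J t) 1) = z J := by
  rw [multilinearOfTuples_apply, Finset.sum_eq_single_of_mem J (Finset.mem_univ _)]
  · simp
  · intro K _ hK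
    obtain ⟨t, ht⟩ := Function.ne_iff.1 hK
    rw [Finset.prod_eq_zero (Finset.mem_univ t), zero_smul]
    simp [ht]

theorem multilinearOfTuples_comp_perm {l : ℕ} {z : (Fin l → Fin n) → F}
    (hz : ∀ K (σ : Equiv.Perm (Fin l)), z (K ∘ σ) = z K) (σ : Equiv.Perm (Fin l))
    (v : Fin l → Coord n) : multilinearOfTuples z (v ∘ σ) = multilinearOfTuples z v := by
  rw [multilinearOfTuples_apply, multilinearOfTuples_apply]
  -- A permutation of the arguments is absorbed by reindexing the tuples `K` as `K ∘ σ⁻¹`.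
  refine Fintype.sum_equiv (σ.arrowCongr (Equiv.refl _)) _ _ fun K => ?_
  have h1 : σ.arrowCongr (Equiv.refl (Fin n)) K = K ∘ σ.symm := rfl
  rw [h1, hz]
  congr 1
  exact Fintype.prod_equiv σ _ _ fun t => by simp

theorem componentMap_surjective (b : Module.Basis (Fin m) ℝ F) :
    Function.Surjective (componentMap (n := n) (r := r) b) := by
  intro c
  -- The value on an arbitrary tuple is prescribed through its sorted version, which is what makes
  -- the resulting maps symmetric.
  let z : ∀ l : Fin (r + 1), (Fin l → Fin n) → F := fun l K =>
    ∑ α, c ⟨l, K ∘ Tuple.sort K, Tuple.monotone_sort K⟩ α • b α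
  have hz : ∀ l K (σ : Equiv.Perm (Fin (l : Fin (r + 1)))), z l (K ∘ σ) = z l K := by
    intro l K σ
    simp only [z, Tuple.comp_perm_comp_sort_eq_comp_sort]
  refine ⟨⟨fun l => multilinearOfTuples (z l),
    fun l σ v => multilinearOfTuples_comp_perm (hz l) σ v⟩, ?_⟩
  funext J α
  change b.repr (multilinearOfTuples (z J.1) _) α = _
  rw [multilinearOfTuples_single]
  have hJ : J.2.1 ∘ Tuple.sort J.2.1 = J.2.1 := by
    rw [Tuple.sort_eq_refl_iff_monotone.2 J.2.2]
    rfl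
  have hJ' : (⟨J.1, J.2.1 ∘ Tuple.sort J.2.1, Tuple.monotone_sort J.2.1⟩ : MultiIndex n r) = J :=
    Sigma.ext rfl (heq_of_eq (Subtype.ext hJ))
  simp only [z, hJ']
  rw [b.repr_sum_self]

/-- The components are coordinates on the space of arrays of symmetric multilinear maps. -/
def componentEquiv (b : Module.Basis (Fin m) ℝ F) :
    JetModel (Coord n) F r ≃ₗ[ℝ] (MultiIndex n r → Fin m → ℝ) :=
  LinearEquiv.ofBijective (componentMap b) ⟨componentMap_injective b, componentMap_surjective b⟩

theorem componentEquiv_apply (b : Module.Basis (Fin m) ℝ F) (a : JetModel (Coord n) F r)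
    (J : MultiIndex n r) (α : Fin m) : componentEquiv b a J α = component b a J α := rfl

/-- The components of the value and of the derivative are coordinates on the space of first jets. -/
def firstJetComponentEquiv (b : Module.Basis (Fin m) ℝ F) :
    JetModel (Coord n) (JetModel (Coord n) F r) 1 ≃ₗ[ℝ]
      (MultiIndex n r → Fin m → ℝ) × (Fin n → MultiIndex n r → Fin m → ℝ) :=
  firstJet ≪≫ₗ (componentEquiv b).prodCongr
    ((LinearMap.toContinuousLinearMap.symm ≪≫ₗ
      ((EuclideanSpace.basisFun (Fin n) ℝ).toBasis.constr ℝ).symm) ≪≫ₗ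
        LinearEquiv.piCongrRight fun _ => componentEquiv b)

theorem firstJetComponentEquiv_snd (b : Module.Basis (Fin m) ℝ F)
    (a : JetModel (Coord n) (JetModel (Coord n) F r) 1) (j : Fin n) (J : MultiIndex n r)
    (α : Fin m) :
    (firstJetComponentEquiv b a).2 j J α = component b (orderOne a j) J α := by
  rw [orderOne_eq, ← componentEquiv_apply]
  change componentEquiv b ((firstJet a).2 ((EuclideanSpace.basisFun (Fin n) ℝ).toBasis j)) J α = _
  simp

end Components

/-! ### Components of linear functionals. -/

section Functionals

variable {I A K : Type*} [Fintype I] [Fintype A] [Fintype K]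

open Classical in
theorem sum_mul_injective {c c' : I → A → ℝ}
    (h : ∀ y : I → A → ℝ, ∑ J, ∑ α, c J α * y J α = ∑ J, ∑ α, c' J α * y J α) : c = c' := by
  funext J α
  simpa [Pi.single_apply, ite_apply] using h (Pi.single J (Pi.single α 1))

open Classical in
theorem exists_eq_sum_mul (f : (I → A → ℝ) →ₗ[ℝ] ℝ) :
    ∃ c : I → A → ℝ, ∀ y, f y = ∑ J, ∑ α, c J α * y J α := by
  refine ⟨fun J α => f (Pi.single J (Pi.single α 1)), fun y => ?_⟩
  conv_lhs => rw [show y = ∑ J, ∑ α, y J α • (Pi.single J (Pi.single α 1) : I → A → ℝ) by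
    funext J α
    simp [Finset.sum_apply, Pi.single_apply, ite_apply]]
  simp [map_sum, mul_comm]

/-- Linear functionals have unique components. -/
theorem existsUnique_components (f : (I → A → ℝ) × (K → I → A → ℝ) →ₗ[ℝ] ℝ) :
    ∃! c : (I → A → ℝ) × (I → A → K → ℝ), ∀ y, f y =
      (∑ J, ∑ α, c.1 J α * y.1 J α) + ∑ J, ∑ α, ∑ j, c.2 J α j * y.2 j J α := by
  classical
  have hsum : ∀ (c : I → A → K → ℝ) (y : K → I → A → ℝ),
      ∑ J, ∑ α, ∑ j, c J α j * y j J α = ∑ j, ∑ J, ∑ α, c J α j * y j J α := by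
    intro c y
    rw [Finset.sum_comm]
    conv_rhs => rw [Finset.sum_comm]; enter [2, J]; rw [Finset.sum_comm]
    rw [Finset.sum_comm]
  obtain ⟨c₀, h₀⟩ := exists_eq_sum_mul (f ∘ₗ LinearMap.inl ℝ _ _)
  choose c₁ h₁ using fun j => exists_eq_sum_mul
    (f ∘ₗ LinearMap.inr ℝ _ _ ∘ₗ LinearMap.single ℝ (fun _ : K => I → A → ℝ) j)
  refine ⟨(c₀, fun J α j => c₁ j J α), fun y => ?_, ?_⟩
  · rw [hsum]
    have h2 : f (0, y.2) = ∑ j, f (0, Pi.single j (y.2 j)) := by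
      conv_lhs => rw [← Finset.univ_sum_single y.2]
      exact map_sum (f ∘ₗ LinearMap.inr ℝ _ _) _ _
    rw [show y = (y.1, 0) + (0, y.2) by simp, map_add, h2]
    refine (congrArg₂ _ (h₀ y.1) (Finset.sum_congr rfl fun j _ => h₁ j (y.2 j))).trans ?_
    simp
  · rintro ⟨e₀, e₁⟩ he
    refine Prod.ext (sum_mul_injective fun y => ?_) ?_
    · rw [← h₀ y]
      exact ((he (y, 0)).trans (by simp)).symm
    · funext J α j
      refine congrFun (congrFun (sum_mul_injective (c := fun J α => e₁ J α j) (c' := c₁ j)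
        fun y => ?_) J) α
      rw [← h₁ j y]
      refine ((he (0, Pi.single j y)).trans ?_).symm
      rw [hsum, Finset.sum_eq_single_of_mem j (Finset.mem_univ _) fun k _ hk => by simp [hk]]
      simp

end Functionals

end HyperStress

namespace HyperStress

open Module

/-! ### The algebraic isomorphisms over `ℝⁿ`, with the determinant as reference form. -/

section Determinant

variable {d : ℕ}

theorem detForm_apply_basisFun (n : ℕ) :
    detForm n (fun j => EuclideanSpace.single j 1) = 1 := by
  have h := (EuclideanSpace.basisFun (Fin n) ℝ).toBasis.det_self
  rw [show ⇑(EuclideanSpace.basisFun (Fin n) ℝ).toBasis = fun j => EuclideanSpace.single j 1 by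
    funext j; simp] at h
  exact h

theorem detForm_ne_zero (n : ℕ) : detForm n ≠ 0 := fun h => by
  simpa [h] using detForm_apply_basisFun n

variable (d) in
theorem exists_basis_detForm :
    ∃ b : Basis Unit ℝ (Coord (d + 1) [⋀^Fin (d + 1)]→L[ℝ] ℝ), b () = detForm (d + 1) :=
  exists_basis_of_ne_zero (EuclideanSpace.basisFun (Fin (d + 1)) ℝ).toBasis (detForm_ne_zero _)

variable (U : Type*) [NormedAddCommGroup U] [NormedSpace ℝ U] [FiniteDimensional ℝ U]

theorem lift_interiorProd_bijective : Function.Bijective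
    (TensorProduct.lift (interiorProd (E := Coord (d + 1)) (d := d))) := by
  obtain ⟨b, hb⟩ := exists_basis_detForm d
  refine lift_bijective b _ ?_
  rw [hb]
  exact interiorProd_bijective (EuclideanSpace.basisFun _ ℝ).toBasis (detForm_ne_zero _)

theorem tensorToHom_form_bijective : Function.Bijective
    (tensorToHom (Coord (d + 1)) U (Coord (d + 1) [⋀^Fin (d + 1)]→L[ℝ] ℝ)) := by
  obtain ⟨b, -⟩ := exists_basis_detForm d
  exact tensorToHom_bijective (EuclideanSpace.basisFun _ ℝ).toBasis b

theorem tensorContract_interiorProd_bijective : Function.Bijective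
    (tensorContract U _ (interiorProd (E := Coord (d + 1)) (d := d))) := by
  obtain ⟨b, hb⟩ := exists_basis_detForm d
  refine tensorContract_bijective (EuclideanSpace.basisFun _ ℝ).toBasis b _ ?_
  rw [hb]
  exact interiorProd_bijective (EuclideanSpace.basisFun _ ℝ).toBasis (detForm_ne_zero _)

variable (d) in
/-- The isomorphism of `L(L(T, U), ⋀ⁿT*)` and `L(U, ⋀ⁿ⁻¹T*)` through `T ⊗ U* ⊗ ⋀ⁿT*`. -/
def tractionOfHom : ((Coord (d + 1) →L[ℝ] U) →ₗ[ℝ] Coord (d + 1) [⋀^Fin (d + 1)]→L[ℝ] ℝ) →ₗ[ℝ]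
    (U →L[ℝ] Coord (d + 1) [⋀^Fin d]→L[ℝ] ℝ) :=
  LinearMap.toContinuousLinearMap.toLinearMap ∘ₗ tensorContract U _ interiorProd ∘ₗ
    (LinearEquiv.ofBijective _ (tensorToHom_form_bijective U)).symm.toLinearMap

variable {U}

theorem tractionOfHom_tensorToHom (τ) :
    tractionOfHom d U (tensorToHom _ U _ τ) =
      LinearMap.toContinuousLinearMap (tensorContract U _ interiorProd τ) := by
  have h : (LinearEquiv.ofBijective _ (tensorToHom_form_bijective (d := d) U)).symm
      (tensorToHom _ U _ τ) = τ := (LinearEquiv.symm_apply_eq _).2 rfl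
  simp [tractionOfHom, h]

/-- The map does not involve bases, so `e` and `b` are free: they are adapted to a chart in one use
and standard in the other. -/
theorem tractionOfHom_apply {n : ℕ} (e : Basis (Fin n) ℝ (Coord (d + 1)))
    (b : Basis Unit ℝ (Coord (d + 1) [⋀^Fin (d + 1)]→L[ℝ] ℝ))
    (H : (Coord (d + 1) →L[ℝ] U) →ₗ[ℝ] Coord (d + 1) [⋀^Fin (d + 1)]→L[ℝ] ℝ) (u : U) :
    tractionOfHom d U H u =
      ∑ j, b.repr (H (coordSMul e j u)) () • interiorProd (e j) (b ()) := by
  obtain ⟨τ, rfl⟩ := (tensorToHom_form_bijective U).2 H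
  rw [tractionOfHom_tensorToHom]
  exact tensorContract_eq_sum e b _ τ u

end Determinant

/-! ### The map `p_σ` on fibres, evaluated in the bases given by a chart. -/

section Traction

variable {d m r : ℕ} {F X : Type*}
  [NormedAddCommGroup F] [NormedSpace ℝ F] [FiniteDimensional ℝ F]
  [TopologicalSpace X] [ChartedSpace (Coord (d + 1)) X] [IsManifold 𝓘(ℝ, Coord (d + 1)) ∞ X]
  {W : X → Type*} [TopologicalSpace (TotalSpace F W)] [∀ x, TopologicalSpace (W x)]
  [∀ x, AddCommGroup (W x)] [∀ x, Module ℝ (W x)] [FiberBundle F W] [VectorBundle ℝ F W]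
  [ContMDiffVectorBundle ∞ F W 𝓘(ℝ, Coord (d + 1))]

/-- The base vectors of a chart as a basis. -/
def chartBasis (i : AdaptedChart (Coord (d + 1)) F W) {x : X} (hx : x ∈ i.dom) :
    Basis (Fin (d + 1)) ℝ (Coord (d + 1)) :=
  (EuclideanSpace.basisFun (Fin (d + 1)) ℝ).toBasis.map
    (show Coord (d + 1) ≃L[ℝ] Coord (d + 1) from (i.chartDeriv hx).symm).toLinearEquiv

theorem chartBasis_apply (i : AdaptedChart (Coord (d + 1)) F W) {x : X} (hx : x ∈ i.dom)
    (j : Fin (d + 1)) : chartBasis i hx j = baseVector i.chart x j := by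
  rw [baseVector, ← i.coe_chartDeriv hx]
  have : ((i.chartDeriv hx : TangentSpace 𝓘(ℝ, Coord (d + 1)) x →L[ℝ] Coord (d + 1))).inverse =
      ((i.chartDeriv hx).symm : Coord (d + 1) →L[ℝ] TangentSpace 𝓘(ℝ, Coord (d + 1)) x) :=
    ContinuousLinearMap.inverse_equiv _
  change (i.chartDeriv hx).symm ((EuclideanSpace.basisFun (Fin (d + 1)) ℝ).toBasis j) =
    ((i.chartDeriv hx : TangentSpace 𝓘(ℝ, Coord (d + 1)) x →L[ℝ] Coord (d + 1))).inverse _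
  rw [this]
  simp

theorem coordVolume_eq (i : AdaptedChart (Coord (d + 1)) F W) {x : X} (hx : x ∈ i.dom) :
    coordVolume i.chart x = (detForm (d + 1)).compContinuousLinearMap
      (i.chartDeriv hx : TangentSpace 𝓘(ℝ, Coord (d + 1)) x →L[ℝ] Coord (d + 1)) := by
  rw [i.coe_chartDeriv hx]
  rfl

theorem coordVolume_comp_symm (i : AdaptedChart (Coord (d + 1)) F W) {x : X} (hx : x ∈ i.dom) :
    (coordVolume i.chart x).compContinuousLinearMap
      ((i.chartDeriv hx).symm : Coord (d + 1) →L[ℝ] TangentSpace 𝓘(ℝ, Coord (d + 1)) x) =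
        detForm (d + 1) := by
  rw [coordVolume_eq i hx]
  apply ContinuousAlternatingMap.ext
  intro v
  refine congrArg (detForm (d + 1)) (funext fun t => ?_)
  exact (i.chartDeriv hx).apply_symm_apply (v t)

theorem coordVolume_ne_zero (i : AdaptedChart (Coord (d + 1)) F W) {x : X} (hx : x ∈ i.dom) :
    coordVolume i.chart x ≠ 0 := by
  intro h
  have := coordVolume_comp_symm i hx
  rw [h] at this
  exact detForm_ne_zero (d + 1) this.symm

theorem exists_basis_coordVolume (i : AdaptedChart (Coord (d + 1)) F W) {x : X} (hx : x ∈ i.dom) :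
    ∃ b : Basis Unit ℝ (Coord (d + 1) [⋀^Fin (d + 1)]→L[ℝ] ℝ), b () = coordVolume i.chart x :=
  exists_basis_of_ne_zero (chartBasis i hx) (coordVolume_ne_zero i hx)

theorem mem_dom_prolong (i : AdaptedChart (Coord (d + 1)) F W) {x : X} (hx : x ∈ i.dom) :
    x ∈ (i.prolong r).dom := ⟨hx.1, hx⟩

variable (d r F W) in
/-- The map `p_σ`: restriction of a non-holonomic stress to the vertical subbundle, followed by the
natural isomorphisms. -/
def tractionMap (x : X) : NonholonomicStress d F W r x →ₗ[ℝ] TractionStress d F W r x :=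
  tractionOfHom d (Jet (Coord (d + 1)) F W r x) ∘ₗ
    { toFun P := P.toLinearMap ∘ₗ (Jet.vertical (Coord (d + 1)) (JetModel (Coord (d + 1)) F r)
        (Jet (Coord (d + 1)) F W r) 1 x).subtype ∘ₗ
          (verticalIso (Coord (d + 1)) (JetModel (Coord (d + 1)) F r)
            (Jet (Coord (d + 1)) F W r) x).toLinearMap
      map_add' _ _ := rfl
      map_smul' _ _ := rfl }

theorem tractionMap_eq (x : X) (P : NonholonomicStress d F W r x) (τ)
    (h : ∀ A, tensorToHom (TangentSpace 𝓘(ℝ, Coord (d + 1)) x) (Jet (Coord (d + 1)) F W r x)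
      (Form (Coord (d + 1)) (d + 1) x) τ A = P (verticalIso (Coord (d + 1))
        (JetModel (Coord (d + 1)) F r) (Jet (Coord (d + 1)) F W r) x A))
    (u : Jet (Coord (d + 1)) F W r x) :
    tractionMap d r F W x P u = tensorContract _ _ (contract (Coord (d + 1)) x) τ u := by
  have h1 : tractionMap d r F W x P = tractionOfHom d (Jet (Coord (d + 1)) F W r x)
      (tensorToHom _ _ _ τ) := congrArg (tractionOfHom d _) (LinearMap.ext fun A => (h A).symm)
  exact DFunLike.congr_fun (h1.trans (tractionOfHom_tensorToHom _)) u

theorem tractionMap_apply {n : ℕ} (e : Basis (Fin n) ℝ (Coord (d + 1)))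
    (b : Basis Unit ℝ (Coord (d + 1) [⋀^Fin (d + 1)]→L[ℝ] ℝ)) (x : X)
    (P : NonholonomicStress d F W r x) (u : Jet (Coord (d + 1)) F W r x) :
    tractionMap d r F W x P u = ∑ j, b.repr (P (verticalIso (Coord (d + 1))
        (JetModel (Coord (d + 1)) F r) (Jet (Coord (d + 1)) F W r) x (coordSMul e j u))) () •
          interiorProd (e j) (b ()) :=
  tractionOfHom_apply e b _ u

/-- The coordinates of the vertical jet `dx^j ⊗ u`. -/
theorem firstJet_coord_coordSMul (i : AdaptedChart (Coord (d + 1)) F W) {x : X} (hx : x ∈ i.dom)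
    (j : Fin (d + 1)) (u : Jet (Coord (d + 1)) F W r x) :
    firstJet (Jet.coord (i.prolong r) (verticalIso (Coord (d + 1))
        (JetModel (Coord (d + 1)) F r) (Jet (Coord (d + 1)) F W r) x
          (coordSMul (chartBasis i hx) j u) : Jet (Coord (d + 1)) (JetModel (Coord (d + 1)) F r)
            (Jet (Coord (d + 1)) F W r) 1 x)) =
      (0, coordSMul (EuclideanSpace.basisFun (Fin (d + 1)) ℝ).toBasis j (Jet.coord i u)) := by
  refine (firstJet_coord_verticalIso (i.prolong r) (mem_dom_prolong i hx) _).trans ?_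
  refine Prod.ext rfl ?_
  apply ContinuousLinearMap.ext
  intro v
  let D : Coord (d + 1) ≃L[ℝ] Coord (d + 1) := i.chartDeriv hx
  -- The basis dual to `∂_j`, pulled back by the inverse derivative of the chart, is the standard
  -- dual basis.
  have key : coordSMul (chartBasis i hx) j u (D.symm v) =
      (EuclideanSpace.basisFun (Fin (d + 1)) ℝ).toBasis.repr v j • u := by
    rw [coordSMul_apply]
    exact congrArg (fun w => (EuclideanSpace.basisFun (Fin (d + 1)) ℝ).toBasis.repr w j • u)
      (D.apply_symm_apply v)
  change (Jet.triv r i).continuousLinearMapAt ℝ x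
    (coordSMul (chartBasis i hx) j u (D.symm v)) = _
  rw [key, map_smul, Trivialization.continuousLinearMapAt_apply_of_mem _ _ hx]
  rfl

end Traction

end HyperStress

/-! ### Component formulas, and the bundles of forms and stresses in trivializations. -/

namespace HyperStress

open Module

/-- This translates equations with a factor `dx` into scalar equations. -/
theorem eq_smul_basis_iff {L : Type*} [AddCommGroup L] [Module ℝ L] (b : Basis Unit ℝ L)
    (θ : L) (t : ℝ) : θ = t • b () ↔ b.repr θ () = t := by
  constructor
  · rintro rfl
    simp
  · intro h
    apply b.repr.injective
    ext
    simpa using h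

section LocalForm

variable {d m r : ℕ} {F X : Type*}
  [NormedAddCommGroup F] [NormedSpace ℝ F] [FiniteDimensional ℝ F]
  [TopologicalSpace X] [ChartedSpace (Coord (d + 1)) X] [IsManifold 𝓘(ℝ, Coord (d + 1)) ∞ X]
  {W : X → Type*} [TopologicalSpace (TotalSpace F W)] [∀ x, TopologicalSpace (W x)]
  [∀ x, AddCommGroup (W x)] [∀ x, Module ℝ (W x)] [FiberBundle F W] [VectorBundle ℝ F W]
  [ContMDiffVectorBundle ∞ F W 𝓘(ℝ, Coord (d + 1))]

/-- The components of value and derivative identify the fibre with a space of real arrays, and `dx`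
identifies `n`-forms with scalars. A stress thereby becomes a linear functional on arrays. -/
theorem existsUnique_hasStressComponents (i : AdaptedChart (Coord (d + 1)) F W)
    (b : Basis (Fin m) ℝ F) {x : X} (hx : x ∈ i.dom) (P : NonholonomicStress d F W r x) :
    ∃! c : (MultiIndex (d + 1) r → Fin m → ℝ) × (MultiIndex (d + 1) r → Fin m → Fin (d + 1) → ℝ),
      HasStressComponents i b x c.1 c.2 P := by
  obtain ⟨bL, hbL⟩ := exists_basis_coordVolume i hx
  let κ := (coordEquiv 1 (i.prolong r) (mem_dom_prolong i hx)).toLinearEquiv ≪≫ₗ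
    firstJetComponentEquiv b
  let f : (MultiIndex (d + 1) r → Fin m → ℝ) ×
      (Fin (d + 1) → MultiIndex (d + 1) r → Fin m → ℝ) →ₗ[ℝ] ℝ :=
    bL.coord () ∘ₗ P.toLinearMap ∘ₗ κ.symm.toLinearMap
  refine (existsUnique_congr fun c => ?_).1 (existsUnique_components f)
  have hκ : ∀ A, (κ A).1 = (fun J α => component b (orderZero (Jet.coord (i.prolong r) A)) J α) ∧
      (κ A).2 = fun j J α => component b (orderOne (Jet.coord (i.prolong r) A) j) J α := fun A =>
    ⟨rfl, funext fun j => funext fun J => funext fun α => firstJetComponentEquiv_snd b _ j J α⟩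
  have hP : ∀ (t : ℝ) A, P A = t • coordVolume i.chart x ↔ f (κ A) = t := by
    intro t A
    have h1 : f (κ A) = bL.repr (P A) () := by
      change bL.repr (P (κ.symm (κ A))) () = _
      rw [κ.symm_apply_apply]
    rw [h1, ← hbL]
    exact eq_smul_basis_iff bL (P A) t
  constructor
  · intro h A
    refine (hP _ A).2 ((h (κ A)).trans ?_)
    rw [(hκ A).1, (hκ A).2]
  · intro h y
    obtain ⟨A, rfl⟩ := κ.surjective y
    refine ((hP _ A).1 (h A)).trans ?_
    rw [(hκ A).1, (hκ A).2]

/-- The basis `∂_j` and the form `dx` are inserted in the formula for `p_σ`, which then only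
requires the value of `P` on the vertical jets `dx^j ⊗ u`. -/
theorem hasTractionComponents_tractionMap (i : AdaptedChart (Coord (d + 1)) F W)
    (b : Basis (Fin m) ℝ F) {x : X} (hx : x ∈ i.dom) {P : NonholonomicStress d F W r x}
    {P₀ P₁} (h : HasStressComponents i b x P₀ P₁ P) :
    HasTractionComponents i b x P₁ (tractionMap d r F W x P) := by
  intro u
  obtain ⟨bL, hbL⟩ := exists_basis_coordVolume i hx
  rw [tractionMap_apply (chartBasis i hx) bL]
  refine Finset.sum_congr rfl fun j _ => ?_
  refine congrArg₂ (· • ·) ?_ (by rw [hbL, chartBasis_apply]; rfl)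
  refine (eq_smul_basis_iff bL _ _).1 ((h _).trans ?_)
  rw [hbL]
  refine congrArg (· • coordVolume i.chart x) ?_
  -- The jet is vertical, so the terms with `P₀` vanish.
  rw [orderZero_eq, firstJet_coord_coordSMul i hx]
  simp only [orderOne_eq, firstJet_coord_coordSMul i hx, coordSMul_apply]
  simp only [← componentEquiv_apply, map_zero, map_smul, Pi.smul_apply, smul_eq_mul]
  -- The Kronecker delta leaves only the derivative in the direction `j`.
  have hs : ∀ j', (EuclideanSpace.basisFun (Fin (d + 1)) ℝ).toBasis.repr
      (EuclideanSpace.single j' 1) j = if j = j' then 1 else 0 := by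
    intro j'
    simp
  simp [hs]

theorem HasTractionComponents.unique {i : AdaptedChart (Coord (d + 1)) F W}
    {b : Basis (Fin m) ℝ F} {x : X} (hx : x ∈ i.dom) {σ : TractionStress d F W r x}
    {S S'} (h : HasTractionComponents i b x S σ) (h' : HasTractionComponents i b x S' σ) :
    S = S' := by
  -- The forms `∂_j ⌟ dx` are a basis, so the coefficients of `σ u` are determined; varying `u` over
  -- all components then determines `S`.
  let β : Basis (Fin (d + 1)) ℝ (Coord (d + 1) [⋀^Fin d]→L[ℝ] ℝ) := (chartBasis i hx).map
    (LinearEquiv.ofBijective ((interiorProd (E := Coord (d + 1)) (d := d)).flip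
      (coordVolume i.chart x)) (interiorProd_bijective (chartBasis i hx) (coordVolume_ne_zero i hx)))
  have hβ : ∀ j, contract (Coord (d + 1)) x (baseVector i.chart x j) (coordVolume i.chart x) =
      β j := by
    intro j
    rw [← chartBasis_apply i hx]
    simp only [β, Basis.map_apply]
    rfl
  have hS : ∀ {S}, HasTractionComponents i b x S σ → ∀ u j,
      β.repr (σ u) j = ∑ J, ∑ α, S J α j * component b (Jet.coord i u) J α := by
    intro S h u j
    have h1 : σ u = ∑ j, (∑ J, ∑ α, S J α j * component b (Jet.coord i u) J α) • β j :=
      (h u).trans (Finset.sum_congr rfl fun j _ => congrArg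
        ((∑ J, ∑ α, S J α j * component b (Jet.coord i u) J α) • ·) (hβ j))
    exact (congrArg (fun θ => β.repr θ j) h1).trans (congrFun (β.repr_sum_self _) j)
  funext J α j
  refine congrFun (congrFun (sum_mul_injective (c := fun J α => S J α j)
    (c' := fun J α => S' J α j) fun y => ?_) J) α
  obtain ⟨a, rfl⟩ := (componentEquiv b).surjective y
  obtain ⟨u, rfl⟩ := (coordEquiv r i hx).surjective a
  exact (hS h u j).symm.trans (hS h' u j)

/-- Both sides are the derivative of the same change between preferred charts. This links the bundle
structure on forms to pull-back by a chart. -/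
theorem symmL_trivializationAt_tangent {x₀ x : X}
    (hx : x ∈ (AdaptedChart.at' F W x₀ : AdaptedChart (Coord (d + 1)) F W).dom) :
    (trivializationAt (Coord (d + 1)) (TangentSpace 𝓘(ℝ, Coord (d + 1))) x₀).symmL ℝ x =
      (((AdaptedChart.at' F W x₀).chartDeriv hx).symm :
        Coord (d + 1) →L[ℝ] TangentSpace 𝓘(ℝ, Coord (d + 1)) x) := by
  rw [TangentBundle.symmL_trivializationAt_eq_core hx.1, AdaptedChart.coe_chartDeriv_symm]
  refine (tangentCoordChange_def (I := 𝓘(ℝ, Coord (d + 1)))).trans ?_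
  simp only [mfld_simps, fderivWithin_univ]
  rfl

/-- The pull-back of a form by the inverse of the derivative of a chart. -/
def formInChart (i : AdaptedChart (Coord (d + 1)) F W) {x : X} (hx : x ∈ i.dom) (l : ℕ) :
    (Coord (d + 1) [⋀^Fin l]→L[ℝ] ℝ) →ₗ[ℝ] (Coord (d + 1) [⋀^Fin l]→L[ℝ] ℝ) where
  toFun θ := θ.compContinuousLinearMap
    ((i.chartDeriv hx).symm : Coord (d + 1) →L[ℝ] TangentSpace 𝓘(ℝ, Coord (d + 1)) x)
  map_add' _ _ := rfl
  map_smul' _ _ := rfl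

theorem continuousLinearMapAt_form {x₀ x : X}
    (hx : x ∈ (AdaptedChart.at' F W x₀ : AdaptedChart (Coord (d + 1)) F W).dom) (l : ℕ)
    (θ : Form (Coord (d + 1)) l x) :
    (trivializationAt (Coord (d + 1) [⋀^Fin l]→L[ℝ] ℝ) (Form (Coord (d + 1)) l) x₀).continuousLinearMapAt
      ℝ x θ = formInChart (AdaptedChart.at' F W x₀) hx l θ := by
  rw [Trivialization.continuousLinearMapAt_apply_of_mem _ _ (by
    exact ⟨hx.1, mem_univ _⟩)]
  rw [FiberBundle.trivializationAt_continuousAlternatingMap_apply]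
  simp only [ContinuousAlternatingMap.inCoordinates, symmL_trivializationAt_tangent hx]
  have h : (trivializationAt ℝ (Trivial X ℝ) x₀).continuousLinearMapAt ℝ x =
      ContinuousLinearMap.id ℝ ℝ := Bundle.Trivial.continuousLinearMapAt_trivialization ℝ X ℝ x
  rw [h]
  rfl

theorem trivializationAt_tractionStress {x₀ x : X}
    (hx : x ∈ (AdaptedChart.at' F W x₀ : AdaptedChart (Coord (d + 1)) F W).dom)
    (σ : TractionStress d F W r x) (u : JetModel (Coord (d + 1)) F r) :
    (trivializationAt (TractionStressModel d F r) (TractionStress d F W r) x₀ ⟨x, σ⟩).2 u =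
      formInChart (AdaptedChart.at' F W x₀) hx d (σ ((coordEquiv r _ hx).symm u)) := by
  rw [hom_trivializationAt_apply]
  simp only [ContinuousLinearMap.inCoordinates, ContinuousLinearMap.comp_apply]
  rw [continuousLinearMapAt_form hx]
  congr 2
  exact (congrFun ((Jet.triv r (AdaptedChart.at' F W x₀)).symm_continuousLinearEquivAt_eq
    (R := ℝ) hx) u).symm

theorem trivializationAt_nonholonomicStress {x₀ x : X}
    (hx : x ∈ (AdaptedChart.at' F W x₀ : AdaptedChart (Coord (d + 1)) F W).dom)
    (P : NonholonomicStress d F W r x)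
    (a : JetModel (Coord (d + 1)) (JetModel (Coord (d + 1)) F r) 1) :
    (trivializationAt (NonholonomicStressModel d F r) (NonholonomicStress d F W r) x₀ ⟨x, P⟩).2 a =
      formInChart (AdaptedChart.at' F W x₀) hx (d + 1)
        (P ((coordEquiv 1 ((AdaptedChart.at' F W x₀).prolong r) (mem_dom_prolong _ hx)).symm a)) := by
  rw [hom_trivializationAt_apply]
  simp only [ContinuousLinearMap.inCoordinates, ContinuousLinearMap.comp_apply]
  rw [continuousLinearMapAt_form hx]
  congr 2
  exact (congrFun ((Jet.triv 1 ((AdaptedChart.at' F W x₀).prolong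
    r)).symm_continuousLinearEquivAt_eq (R := ℝ) (mem_dom_prolong _ hx)) a).symm

end LocalForm

end HyperStress

namespace HyperStress

open Module

/-! ### Smoothness of `p_σ`. -/

section Smoothness

variable {d m r : ℕ} {F X : Type*}
  [NormedAddCommGroup F] [NormedSpace ℝ F] [FiniteDimensional ℝ F]
  [TopologicalSpace X] [ChartedSpace (Coord (d + 1)) X] [IsManifold 𝓘(ℝ, Coord (d + 1)) ∞ X]
  {W : X → Type*} [TopologicalSpace (TotalSpace F W)] [∀ x, TopologicalSpace (W x)]
  [∀ x, AddCommGroup (W x)] [∀ x, Module ℝ (W x)] [FiberBundle F W] [VectorBundle ℝ F W]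
  [ContMDiffVectorBundle ∞ F W 𝓘(ℝ, Coord (d + 1))]

theorem formInChart_coordVolume (i : AdaptedChart (Coord (d + 1)) F W) {x : X} (hx : x ∈ i.dom) :
    formInChart i hx (d + 1) (coordVolume i.chart x) = detForm (d + 1) :=
  coordVolume_comp_symm i hx

/-- Interior products commute with pull-back, and the right-hand side no longer depends on `x`; this
is why the local expression of `p_σ` is constant. -/
theorem formInChart_interiorProd (i : AdaptedChart (Coord (d + 1)) F W) {x : X} (hx : x ∈ i.dom)
    (j : Fin (d + 1)) :
    formInChart i hx d (interiorProd (chartBasis i hx j) (coordVolume i.chart x)) =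
      interiorProd ((EuclideanSpace.basisFun (Fin (d + 1)) ℝ).toBasis j) (detForm (d + 1)) := by
  rw [← formInChart_coordVolume i hx]
  apply ContinuousAlternatingMap.ext
  intro v
  refine congrArg (coordVolume i.chart x) (funext fun t => ?_)
  induction t using Fin.cases with
  | zero => rfl
  | succ t => rfl

variable (d r F) in
/-- The expression of `p_σ` in local trivializations. -/
def tractionModelMap : NonholonomicStressModel d F r →ₗ[ℝ] TractionStressModel d F r :=
  tractionOfHom d (JetModel (Coord (d + 1)) F r) ∘ₗ
    { toFun Q := Q.toLinearMap ∘ₗ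
        (firstJet (E := Coord (d + 1)) (G := JetModel (Coord (d + 1)) F r)).symm.toLinearMap ∘ₗ
          LinearMap.inr ℝ _ _
      map_add' _ _ := rfl
      map_smul' _ _ := rfl }

theorem tractionModelMap_apply {n : ℕ} (e : Basis (Fin n) ℝ (Coord (d + 1)))
    (b : Basis Unit ℝ (Coord (d + 1) [⋀^Fin (d + 1)]→L[ℝ] ℝ))
    (Q : NonholonomicStressModel d F r) (u : JetModel (Coord (d + 1)) F r) :
    tractionModelMap d r F Q u =
      ∑ j, b.repr (Q (firstJet.symm (0, coordSMul e j u))) () • interiorProd (e j) (b ()) :=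
  tractionOfHom_apply e b _ u

set_option maxHeartbeats 2000000 in
-- The same basis formula is used twice, with `∂_j` and `dx` at `x` and with the standard basis and
-- the determinant in the model. The trivializations match the two term by term.
theorem trivializationAt_tractionMap {x₀ x : X}
    (hx : x ∈ (AdaptedChart.at' F W x₀ : AdaptedChart (Coord (d + 1)) F W).dom)
    (P : NonholonomicStress d F W r x) :
    (trivializationAt (TractionStressModel d F r) (TractionStress d F W r) x₀
      ⟨x, tractionMap d r F W x P⟩).2 = tractionModelMap d r F
        (trivializationAt (NonholonomicStressModel d F r) (NonholonomicStress d F W r) x₀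
          ⟨x, P⟩).2 := by
  obtain ⟨b, hb⟩ := exists_basis_detForm d
  obtain ⟨bL, hbL⟩ := exists_basis_coordVolume _ hx
  apply ContinuousLinearMap.ext
  intro u
  rw [trivializationAt_tractionStress hx, tractionMap_apply (chartBasis _ hx) bL,
    tractionModelMap_apply (EuclideanSpace.basisFun (Fin (d + 1)) ℝ).toBasis b]
  refine (map_sum (formInChart _ hx d) _ _).trans (Finset.sum_congr rfl fun j _ => ?_)
  refine (map_smul (formInChart _ hx d) _ _).trans ?_
  rw [hb, hbL, formInChart_interiorProd]
  refine congrArg (· • interiorProd (d := d) ((EuclideanSpace.basisFun (Fin (d + 1)) ℝ).toBasis j)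
    (detForm (d + 1))) ?_
  rw [trivializationAt_nonholonomicStress hx]
  -- The vertical jets on which the two formulas evaluate the stress correspond, as is seen in the
  -- prolonged coordinates.
  have h1 : (coordEquiv 1 ((AdaptedChart.at' F W x₀).prolong r) (mem_dom_prolong _ hx)).symm
      (firstJet.symm (0, coordSMul (EuclideanSpace.basisFun (Fin (d + 1)) ℝ).toBasis j u)) =
      (verticalIso (Coord (d + 1)) (JetModel (Coord (d + 1)) F r) (Jet (Coord (d + 1)) F W r) x
        (coordSMul (chartBasis _ hx) j ((coordEquiv r _ hx).symm u)) :
          Jet (Coord (d + 1)) (JetModel (Coord (d + 1)) F r) (Jet (Coord (d + 1)) F W r) 1 x) := by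
    rw [ContinuousLinearEquiv.symm_apply_eq, LinearEquiv.symm_apply_eq, coordEquiv_apply,
      firstJet_coord_coordSMul _ hx, ← coordEquiv_apply _ hx, ContinuousLinearEquiv.apply_symm_apply]
  rw [h1]
  symm
  refine (eq_smul_basis_iff b _ _).1 ?_
  -- Pull-back carries `dx` to the determinant, so the coefficient of an `n`-form is preserved.
  rw [hb, ← formInChart_coordVolume _ hx, ← hbL, ← map_smul]
  exact congrArg _ ((eq_smul_basis_iff bL _ _).2 rfl)

theorem contDiff_of_finiteDimensional {A V : Type*} [NormedAddCommGroup A] [NormedSpace ℝ A]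
    [FiniteDimensional ℝ A] [NormedAddCommGroup V] [NormedSpace ℝ V] (M : A →ₗ[ℝ] V) :
    ContDiff ℝ ∞ M :=
  (LinearMap.toContinuousLinearMap M).contDiff

/-- The one-element basis of the top-degree forms makes the domain finite-dimensional, where linear
maps are continuous and hence smooth. -/
theorem contDiff_of_linearMap_form {U V : Type*} [NormedAddCommGroup U] [NormedSpace ℝ U]
    [FiniteDimensional ℝ U] [NormedAddCommGroup V] [NormedSpace ℝ V]
    (M : (U →L[ℝ] Coord (d + 1) [⋀^Fin (d + 1)]→L[ℝ] ℝ) →ₗ[ℝ] V) : ContDiff ℝ ∞ M := by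
  obtain ⟨b, -⟩ := exists_basis_detForm d
  have : FiniteDimensional ℝ (Coord (d + 1) [⋀^Fin (d + 1)]→L[ℝ] ℝ) := Module.Finite.of_basis b
  have : FiniteDimensional ℝ (U →L[ℝ] Coord (d + 1) [⋀^Fin (d + 1)]→L[ℝ] ℝ) := inferInstance
  exact contDiff_of_finiteDimensional
    (A := U →L[ℝ] Coord (d + 1) [⋀^Fin (d + 1)]→L[ℝ] ℝ) (V := V) M

variable (d r F) in
theorem contDiff_tractionModelMap : ContDiff ℝ ∞ (tractionModelMap d r F) :=
  contDiff_of_linearMap_form _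

/-- Near each point the fibre coordinate of the image is a fixed linear map applied to the fibre
coordinate of the argument. -/
theorem contMDiff_tractionMap : ContMDiff
    (𝓘(ℝ, Coord (d + 1)).prod 𝓘(ℝ, NonholonomicStressModel d F r))
    (𝓘(ℝ, Coord (d + 1)).prod 𝓘(ℝ, TractionStressModel d F r)) ∞
    (fun v : TotalSpace (NonholonomicStressModel d F r) (NonholonomicStress d F W r) =>
      (⟨v.1, tractionMap d r F W v.1 v.2⟩ :
        TotalSpace (TractionStressModel d F r) (TractionStress d F W r))) := by
  intro v₀
  refine contMDiffAt_totalSpace.2 ⟨contMDiffAt_proj _, ?_⟩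
  have h1 := (contMDiffAt_totalSpace.1 (contMDiffAt_id (I := 𝓘(ℝ, Coord (d + 1)).prod
    𝓘(ℝ, NonholonomicStressModel d F r)) (n := ∞) (x := v₀))).2
  have h2 := (contDiff_tractionModelMap d r F).contMDiff.contMDiffAt
    (x := (trivializationAt (NonholonomicStressModel d F r) (NonholonomicStress d F W r)
      v₀.proj v₀).2)
  refine (h2.comp v₀ h1).congr_of_eventuallyEq ?_
  have h3 : ∀ᶠ v : TotalSpace (NonholonomicStressModel d F r) (NonholonomicStress d F W r) in 𝓝 v₀,
      v.proj ∈ (AdaptedChart.at' F W v₀.proj : AdaptedChart (Coord (d + 1)) F W).dom :=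
    (FiberBundle.continuous_proj _ _).continuousAt.preimage_mem_nhds
      ((AdaptedChart.isOpen_dom _).mem_nhds (AdaptedChart.mem_dom_at' _))
  filter_upwards [h3] with v hv
  exact trivializationAt_tractionMap hv v.2

end Smoothness

end HyperStress

namespace HyperStress

/-! ### Traction fields, and the uniqueness of `p_σ`. -/

section TractionField

variable {d r : ℕ} {F X : Type*}
  [NormedAddCommGroup F] [NormedSpace ℝ F] [FiniteDimensional ℝ F]
  [TopologicalSpace X] [ChartedSpace (Coord (d + 1)) X] [IsManifold 𝓘(ℝ, Coord (d + 1)) ∞ X]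
  {W : X → Type*} [TopologicalSpace (TotalSpace F W)] [∀ x, TopologicalSpace (W x)]
  [∀ x, AddCommGroup (W x)] [∀ x, Module ℝ (W x)] [FiberBundle F W] [VectorBundle ℝ F W]
  [ContMDiffVectorBundle ∞ F W 𝓘(ℝ, Coord (d + 1))]

variable (P : Cₛ^∞⟮𝓘(ℝ, Coord (d + 1)); NonholonomicStressModel d F r, NonholonomicStress d F W r⟯)

theorem contMDiff_tractionMap_section : ContMDiff 𝓘(ℝ, Coord (d + 1))
    (𝓘(ℝ, Coord (d + 1)).prod 𝓘(ℝ, TractionStressModel d F r)) ∞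
    (fun x => (⟨x, tractionMap d r F W x (P x)⟩ :
      TotalSpace (TractionStressModel d F r) (TractionStress d F W r))) :=
  ContMDiff.comp (g := fun v : TotalSpace (NonholonomicStressModel d F r)
      (NonholonomicStress d F W r) => (⟨v.1, tractionMap d r F W v.1 v.2⟩ :
        TotalSpace (TractionStressModel d F r) (TractionStress d F W r)))
    contMDiff_tractionMap P.contMDiff

/-- The traction hyper-stress field induced by a non-holonomic stress field. -/
def tractionField :
    Cₛ^∞⟮𝓘(ℝ, Coord (d + 1)); TractionStressModel d F r, TractionStress d F W r⟯ :=
  ⟨fun x => tractionMap d r F W x (P x), contMDiff_tractionMap_section P⟩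

theorem existsUnique_tractionField :
    ∃! σ : Cₛ^∞⟮𝓘(ℝ, Coord (d + 1)); TractionStressModel d F r, TractionStress d F W r⟯,
      ∀ x, σ x = tractionMap d r F W x (P x) :=
  ⟨tractionField P, fun _ => rfl, fun _ hσ => ContMDiffSection.ext hσ⟩

end TractionField

section Uniqueness

variable {d r : ℕ} {F X : Type*}
  [NormedAddCommGroup F] [NormedSpace ℝ F] [FiniteDimensional ℝ F]
  [TopologicalSpace X] [ChartedSpace (Coord (d + 1)) X] [IsManifold 𝓘(ℝ, Coord (d + 1)) ∞ X]
  {W : X → Type*} [TopologicalSpace (TotalSpace F W)] [∀ x, TopologicalSpace (W x)]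
  [∀ x, AddCommGroup (W x)] [∀ x, Module ℝ (W x)] [FiberBundle F W] [VectorBundle ℝ F W]
  [ContMDiffVectorBundle ∞ F W 𝓘(ℝ, Coord (d + 1))]

/-- A map is `p_σ` if it satisfies its defining condition. -/
theorem eq_tractionMap (x : X) (P : NonholonomicStress d F W r x) (σ : TractionStress d F W r x)
    (h : ∀ τ, (∀ A, tensorToHom (TangentSpace 𝓘(ℝ, Coord (d + 1)) x)
      (Jet (Coord (d + 1)) F W r x) (Form (Coord (d + 1)) (d + 1) x) τ A =
        P (verticalIso (Coord (d + 1)) (JetModel (Coord (d + 1)) F r)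
          (Jet (Coord (d + 1)) F W r) x A)) →
      ∀ u, σ u = tensorContract _ _ (contract (Coord (d + 1)) x) τ u) :
    σ = tractionMap d r F W x P := by
  -- Surjectivity of `h` supplies a tensor to which the defining condition applies; without it the
  -- condition could be vacuous.
  obtain ⟨τ, hτ⟩ := (tensorToHom_form_bijective (d := d) (Jet (Coord (d + 1)) F W r x)).2
    (P.toLinearMap ∘ₗ (Jet.vertical (Coord (d + 1)) (JetModel (Coord (d + 1)) F r)
      (Jet (Coord (d + 1)) F W r) 1 x).subtype ∘ₗ
        (verticalIso (Coord (d + 1)) (JetModel (Coord (d + 1)) F r)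
          (Jet (Coord (d + 1)) F W r) x).toLinearMap)
  have h' := fun A => LinearMap.congr_fun hτ A
  exact ContinuousLinearMap.ext fun u => (h τ h' u).trans (tractionMap_eq x P τ h' u).symm

end Uniqueness

end HyperStress

end

theorem mainTheorem2 {d m k : ℕ} (hk : 1 ≤ k)
    {F : Type*} [NormedAddCommGroup F] [NormedSpace ℝ F] [FiniteDimensional ℝ F]
    {X : Type*} [TopologicalSpace X] [T2Space X]
    [ChartedSpace (Coord (d + 1)) X]
    [IsManifold 𝓘(ℝ, Coord (d + 1)) ∞ X]
    {W : X → Type*} [TopologicalSpace (TotalSpace F W)] [∀ x, TopologicalSpace (W x)]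
    [∀ x, AddCommGroup (W x)] [∀ x, Module ℝ (W x)] [FiberBundle F W] [VectorBundle ℝ F W]
    [ContMDiffVectorBundle ∞ F W 𝓘(ℝ, Coord (d + 1))] :
    -- the natural isomorphism of `L(TX, J^{k-1}W)` and the vertical subbundle of `J¹(J^{k-1}W)`
    ∃ ν : ∀ x : X, (TangentSpace 𝓘(ℝ, Coord (d + 1)) x →L[ℝ]
          Jet (Coord (d + 1)) F W (k - 1) x) ≃ₗ[ℝ]
        Jet.vertical (Coord (d + 1))
          (JetModel (Coord (d + 1)) F (k - 1))
          (Jet (Coord (d + 1)) F W (k - 1)) 1 x,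
      (∀ x, IsVerticalIso (ν x)) ∧
      (∀ x ν', IsVerticalIso ν' → ν' = ν x) ∧
      -- the natural isomorphism `TX ⊗ ⋀ⁿT*X ≅ ⋀ⁿ⁻¹T*X`
      (∀ x : X, Function.Bijective (TensorProduct.lift
        (contract (Coord (d + 1)) (d := d) x))) ∧
      -- the natural isomorphism `TX ⊗ (J^{k-1}W)* ⊗ ⋀ⁿT*X ≅ L(L(TX, J^{k-1}W), ⋀ⁿT*X)`
      (∀ x : X, Function.Bijective (tensorToHom
        (TangentSpace 𝓘(ℝ, Coord (d + 1)) x)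
        (Jet (Coord (d + 1)) F W (k - 1) x)
        (Form (Coord (d + 1)) (d + 1) x))) ∧
      -- the natural isomorphism `TX ⊗ (J^{k-1}W)* ⊗ ⋀ⁿT*X ≅ L(J^{k-1}W, ⋀ⁿ⁻¹T*X)`
      (∀ x : X, Function.Bijective (tensorContract
        (Jet (Coord (d + 1)) F W (k - 1) x)
        (Form (Coord (d + 1)) d x)
        (contract (Coord (d + 1)) (d := d) x))) ∧
      ∃ p : ∀ x : X, NonholonomicStress d F W (k - 1) x →ₗ[ℝ]
          TractionStress d F W (k - 1) x,
        -- `p` is restriction to the vertical subbundle followed by the natural isomorphisms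
        (∀ x P τ,
          (∀ A, tensorToHom _ _ _ τ A = P (ν x A)) →
            ∀ u, p x P u = tensorContract _ _
              (contract (Coord (d + 1)) x) τ u) ∧
        (∀ p' : ∀ x : X, NonholonomicStress d F W (k - 1) x →
            TractionStress d F W (k - 1) x,
          (∀ x P τ,
            (∀ A, tensorToHom _ _ _ τ A = P (ν x A)) →
              ∀ u, p' x P u = tensorContract _ _
                (contract (Coord (d + 1)) x) τ u) →
          ∀ x P, p' x P = p x P) ∧
        -- `p` is a smooth morphism of vector bundles
        ContMDiff
          (𝓘(ℝ, Coord (d + 1)).prod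
            𝓘(ℝ, NonholonomicStressModel d F (k - 1)))
          (𝓘(ℝ, Coord (d + 1)).prod
            𝓘(ℝ, TractionStressModel d F (k - 1))) ∞
          (fun v : TotalSpace (NonholonomicStressModel d F (k - 1))
              (NonholonomicStress d F W (k - 1)) =>
            (⟨v.1, p v.1 v.2⟩ : TotalSpace (TractionStressModel d F (k - 1))
              (TractionStress d F W (k - 1)))) ∧
        -- a non-holonomic stress field induces a unique traction hyper-stress field
        (∀ P : Cₛ^∞⟮𝓘(ℝ, Coord (d + 1));
            NonholonomicStressModel d F (k - 1),
            NonholonomicStress d F W (k - 1)⟯,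
          ∃! σ : Cₛ^∞⟮𝓘(ℝ, Coord (d + 1));
              TractionStressModel d F (k - 1),
              TractionStress d F W (k - 1)⟯,
            ∀ x, σ x = p x (P x)) ∧
        -- in all adapted coordinates, `σ_α^{Jj}` is the first order part of the stress
        ∀ (i : AdaptedChart (Coord (d + 1)) F W)
          (b : Module.Basis (Fin m) ℝ F), ∀ x ∈ i.dom,
          ∀ P : NonholonomicStress d F W (k - 1) x,
            (∃! c : (MultiIndex (d + 1) (k - 1) → Fin m → ℝ) ×
                (MultiIndex (d + 1) (k - 1) → Fin m → Fin (d + 1) → ℝ),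
              HasStressComponents i b x c.1 c.2 P) ∧
            ∀ P₀ P₁, HasStressComponents i b x P₀ P₁ P →
              ∀ S, HasTractionComponents i b x S (p x P) ↔ S = P₁ := by
  refine ⟨fun x => verticalIso (Coord (d + 1)) (JetModel (Coord (d + 1)) F (k - 1))
      (Jet (Coord (d + 1)) F W (k - 1)) x, fun x => isVerticalIso_verticalIso x,
    fun x ν' h => h.unique (isVerticalIso_verticalIso x), fun x => lift_interiorProd_bijective,
    fun x => tensorToHom_form_bijective (Jet (Coord (d + 1)) F W (k - 1) x),
    fun x => tensorContract_interiorProd_bijective (Jet (Coord (d + 1)) F W (k - 1) x),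
    fun x => tractionMap d (k - 1) F W x, tractionMap_eq,
    fun p' hp' x P => eq_tractionMap x P (p' x P) (hp' x P), contMDiff_tractionMap,
    existsUnique_tractionField, fun i b x hx P =>
      ⟨existsUnique_hasStressComponents i b hx P, fun P₀ P₁ h S => ⟨fun hS => ?_, ?_⟩⟩⟩
  · exact HasTractionComponents.unique hx hS (hasTractionComponents_tractionMap i b hx h)
  · rintro rfl
    exact hasTractionComponents_tractionMap i b hx h
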